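/- Let $P,Q,R:(\mathbb C^3,0)\to\mathbb C$ be holomorphic germs of order at least $4$ at the origin, let $R_{040}$ be the coefficient of $y^4$ in the power series of $R$, and assume $R_{040}\neq 0$. Consider the tangent to the identity germ $$f(x,y,z)=\bigl(x+yz(y-z)+P,\; y+x(x^2-z^2)+Q,\; z+xz(y-z)+R\bigr).$$ **The modification.** For a blow-up of a point with centred coordinates $(x,y,z)$, the $x$-chart, $y$-chart, $z$-chart are the copies of $\mathbb C^3$ in which the blow-up reads $(x,xy,xz)$, $(xy,y,yz)$, $(xz,yz,z)$ respectively. Let $\pi_1:X_1\to\mathbb C^3$ be the blow-up of the origin; $\pi_2:X_2\to X_1$ the blow-up of the point $p_5=[0:1:0]$ of $\pi_1^{-1}(0)$ (the origin of the $y$-chart of $\pi_1$); $\pi_3:X_3\to X_2$ the blow-up of the point $[1:0:0]$ of $\pi_2^{-1}(p_5)$ (the origin of the $x$-chart of $\pi_2$); and $\pi_4:X_4\to X_3$ the blow-up of the projective line $L=\{[p:0:r]\}$ in the exceptional plane of $\pi_3$. Put $\pi_0=\pi_1\circ\pi_2\circ\pi_3\circ\pi_4:X_{\pi_0}=X_4\to\mathbb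 C^3$ and let $D=\pi_0^{-1}(0)$. The line $L$ is $\{x=y=0\}$ in the $x$-chart of $\pi_3$, where $\pi_4$ has a chart $A$ with $\pi_4(x,y,z)=(x,xy,z)$; and it is $\{y=z=0\}$ in the $z$-chart of $\pi_3$, where $\pi_4$ has the charts $B$ with $\pi_4(x,y,z)=(x,yz,z)$ and $C$ with $\pi_4(x,y,z)=(x,y,yz)$. **The points.** Let $p_1,p_2,p_3,p_4\in X_{\pi_0}$ be the points lying over the points $[0:0:1],[0:1:1],[1:1:1],[-1:1:1]$ of $\pi_1^{-1}(0)$, where $\pi_2\circ\pi_3\circ\pi_4$ is an isomorphism. Let $q_1,q_2$ be the points $(0,0,0)$, $(0,0,\tfrac12)$ of the chart $A$, let $q_3,q_4$ be the points $(0,0,0)$, $\bigl(0,\tfrac1{2R_{040}},0\bigr)$ of the chart $B$, and let $q_5$ be the origin of the chart $C$. **The vector field.** The infinitesimal generator of a tangent to the identity germ $g$ is the unique formal vector field $\chi$ of multiplicity at least $2$ with $g=\exp\chi$. Dividing it by the greatest common divisor of its coefficients gives the saturated infinitesimal generator $\hat\chi$, defined up to multiplication by a unit. At a point of $D$, a saturated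 formal vector field is called *canonical* if it is tangent to $D$, is either regular or has a non-nilpotent linear part, and is not radial; *radial* means tangent to $D$ with linear part having eigenvalues $\lambda n_1,\lambda n_2,\lambda n_3$ for some $\lambda\in\mathbb C\setminus\{0\}$ and positive integers $n_1,n_2,n_3$. **Claim.** At every point of $D$ the lift $f_{\pi_0}$ of $f$ to $X_{\pi_0}$ defines a germ that fixes the point and is tangent to the identity, and so has a saturated infinitesimal generator $\hat\chi_{\pi_0}$. The points of $D$ at which $\hat\chi_{\pi_0}$ is singular are exactly $p_1,\dots,p_4,q_1,\dots,q_5$; in particular they are isolated in the set of singular points on $D$. At each of them $\hat\chi_{\pi_0}$ is canonical. If moreover the origin is an isolated fixed point of $f$, then each of these points is an isolated singularity of $\hat\chi_{\pi_0}$ in $X_{\pi_0}$ as well, i.e. the ideal generated by the coefficients of $\hat\chi_{\pi_0}$ contains a power of the maximal ideal. -/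

import Mathlib

open scoped Topology

namespace BlowUpResolution

/-! ### The modification `X₄ → X₃ → X₂ → X₁ → ℂ³` -/

/-- Points of `ℂ³`. The coordinates `x, y, z` are numbered `0, 1, 2`. -/
abbrev Pt := Fin 3 → ℂ

/-- The blow-up of affine 3-space along the coordinate subspace `{w_i = 0 for all i ∈ S}`, read in
the `w_j`-chart (`j ∈ S`): the coordinates `w_i` with `i ∈ S`, `i ≠ j`, are multiplied by `w_j`, the
others are kept. `S = univ` is the blow-up of the origin, a two-element `S` is the blow-up of a
coordinate line. The formula makes sense in every ring, so that it can be applied to points and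
also to triples of power series. -/
def blowUpChart {A : Type*} [Mul A] (S : Finset (Fin 3)) (j : Fin 3) (w : Fin 3 → A) : Fin 3 → A :=
  fun i => if i ∈ S ∧ i ≠ j then w i * w j else w i

/-- The charts of `X₁`, the blow-up `π₁` of the origin of `ℂ³`. Every chart is a copy of `ℂ³`. -/
inductive ChartOne
  | x | y | z

/-- The map to `ℂ³` in the charts of `X₁`. -/
def toBaseOne {A : Type*} [Mul A] : ChartOne → (Fin 3 → A) → (Fin 3 → A)
  | .x => blowUpChart Finset.univ 0
  | .y => blowUpChart Finset.univ 1
  | .z => blowUpChart Finset.univ 2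

/-- The charts of `X₂`, the blow-up `π₂` of the point `p₅ ∈ X₁` given by the direction `[0 : 1 : 0]`.
This point is the origin of the `y`-chart and lies in no other chart, so the `y`-chart is replaced by
three charts and the two others are kept. -/
inductive ChartTwo
  | x | z | yx | yy | yz

/-- The map to `ℂ³` in the charts of `X₂`. -/
def toBaseTwo {A : Type*} [Mul A] : ChartTwo → (Fin 3 → A) → (Fin 3 → A)
  | .x => toBaseOne .x
  | .z => toBaseOne .z
  | .yx => toBaseOne .y ∘ blowUpChart Finset.univ 0
  | .yy => toBaseOne .y ∘ blowUpChart Finset.univ 1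
  | .yz => toBaseOne .y ∘ blowUpChart Finset.univ 2

/-- The charts of `X₃`, the blow-up `π₃` of the point `p₅,₁ ∈ X₂` given by the direction
`[1 : 0 : 0]` at `p₅`. This point is the origin of the chart `yx` and lies in no other chart. -/
inductive ChartThree
  | x | z | yy | yz | yxx | yxy | yxz

/-- The map to `ℂ³` in the charts of `X₃`. -/
def toBaseThree {A : Type*} [Mul A] : ChartThree → (Fin 3 → A) → (Fin 3 → A)
  | .x => toBaseTwo .x
  | .z => toBaseTwo .z
  | .yy => toBaseTwo .yy
  | .yz => toBaseTwo .yz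
  | .yxx => toBaseTwo .yx ∘ blowUpChart Finset.univ 0
  | .yxy => toBaseTwo .yx ∘ blowUpChart Finset.univ 1
  | .yxz => toBaseTwo .yx ∘ blowUpChart Finset.univ 2

/-- The charts of `X₄ = X_{π₀}`, the blow-up `π₄` of the projective line `L` of the directions
`[p : 0 : r]` in the exceptional plane of `π₃`. This line is `{x = y = 0}` in the chart `yxx`,
`{y = z = 0}` in the chart `yxz`, and does not meet any other chart. -/
inductive ChartFour
  | x | z | yy | yz | yxy | yxxx | yxxy | yxzz | yxzy

/-- The map `π₀ = π₁ ∘ π₂ ∘ π₃ ∘ π₄` to `ℂ³` in the charts of `X₄`. -/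
def toBaseFour {A : Type*} [Mul A] : ChartFour → (Fin 3 → A) → (Fin 3 → A)
  | .x => toBaseThree .x
  | .z => toBaseThree .z
  | .yy => toBaseThree .yy
  | .yz => toBaseThree .yz
  | .yxy => toBaseThree .yxy
  | .yxxx => toBaseThree .yxx ∘ blowUpChart {0, 1} 0
  | .yxxy => toBaseThree .yxx ∘ blowUpChart {0, 1} 1
  | .yxzz => toBaseThree .yxz ∘ blowUpChart {1, 2} 2
  | .yxzy => toBaseThree .yxz ∘ blowUpChart {1, 2} 1

/-- Two points in two charts are the same point of the modification when there are holomorphic germs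
`φ`, `ψ` between the charts at these points which commute with the maps to `ℂ³`. The map to `ℂ³` is
injective in every chart outside the exceptional divisor, so `φ` and `ψ` are unique and inverse to
each other: they are the coordinate change and its inverse. -/
def SamePoint {ι : Type} (m : ι → Pt → Pt) (a b : ι × Pt) : Prop :=
  ∃ φ ψ : Pt → Pt,
    AnalyticAt ℂ φ a.2 ∧ φ a.2 = b.2 ∧ (∀ᶠ w in 𝓝 a.2, m b.1 (φ w) = m a.1 w) ∧
    AnalyticAt ℂ ψ b.2 ∧ ψ b.2 = a.2 ∧ (∀ᶠ w in 𝓝 b.2, m a.1 (ψ w) = m b.1 w)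

theorem samePoint_refl {ι : Type} (m : ι → Pt → Pt) (a : ι × Pt) : SamePoint m a a :=
  ⟨id, id, analyticAt_id, rfl, Filter.Eventually.of_forall fun _ => rfl,
    analyticAt_id, rfl, Filter.Eventually.of_forall fun _ => rfl⟩

theorem samePoint_symm {ι : Type} (m : ι → Pt → Pt) {a b : ι × Pt} (h : SamePoint m a b) :
    SamePoint m b a := by
  obtain ⟨φ, ψ, h1, h2, h3, h4, h5, h6⟩ := h
  exact ⟨ψ, φ, h4, h5, h6, h1, h2, h3⟩

theorem samePoint_trans {ι : Type} (m : ι → Pt → Pt) {a b c : ι × Pt} (h : SamePoint m a b)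
    (k : SamePoint m b c) : SamePoint m a c := by
  obtain ⟨φ, ψ, h1, h2, h3, h4, h5, h6⟩ := h
  obtain ⟨φ', ψ', k1, k2, k3, k4, k5, k6⟩ := k
  have hc : Filter.Tendsto φ (𝓝 a.2) (𝓝 b.2) := h2 ▸ h1.continuousAt
  have kc : Filter.Tendsto ψ' (𝓝 c.2) (𝓝 b.2) := k5 ▸ k4.continuousAt
  refine ⟨φ' ∘ φ, ψ ∘ ψ', ?_, ?_, ?_, ?_, ?_, ?_⟩
  · exact AnalyticAt.comp (by rw [h2]; exact k1) h1
  · simp [h2, k2]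
  · filter_upwards [h3, hc.eventually k3] with w hw hw'
    exact hw'.trans hw
  · exact AnalyticAt.comp (by rw [k5]; exact h4) k4
  · simp [h5, k5]
  · filter_upwards [k6, kc.eventually h6] with w hw hw'
    exact hw'.trans hw

/-- Identification of chart points of `X₄`. -/
def setoidFour : Setoid (ChartFour × Pt) where
  r := SamePoint toBaseFour
  iseqv := ⟨samePoint_refl _, samePoint_symm _, samePoint_trans _⟩

/-- The space `X₄ = X_{π₀}`, glued from its nine charts. -/
def XFour : Type := Quotient setoidFour

/-- The point of `X₄` with coordinates `u` in the chart `c`. -/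
def XFour.mk (c : ChartFour) (u : Pt) : XFour := Quotient.mk setoidFour (c, u)

/-- The modification `π₀ : X₄ → ℂ³`. -/
def XFour.proj : XFour → Pt :=
  Quotient.lift (fun a : ChartFour × Pt => toBaseFour a.1 a.2) (by
    rintro a b ⟨φ, ψ, -, h2, h3, -⟩
    have h := h3.self_of_nhds
    rw [h2] at h
    exact h.symm)

/-- The components of the exceptional divisor `π₀⁻¹(0)` through the point with coordinates `u` in the
chart `c`. In every chart this divisor is a union of coordinate planes, so a component is given by the
index of the coordinate that vanishes on it. -/
def excComponents (c : ChartFour) (u : Pt) : Set (Fin 3) :=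
  {i | u i = 0 ∧ ∀ w : Pt, w i = 0 → toBaseFour c w = 0}

/-! ### Formal vector fields -/

/-- Formal power series in three variables. -/
abbrev Series := MvPowerSeries (Fin 3) ℂ

/-- A power series with a positive radius of convergence, that is, the Taylor series of a holomorphic
germ `(ℂ³, 0) → ℂ`. -/
def IsConvergent (φ : Series) : Prop :=
  ∃ r : ℝ, 0 < r ∧ Summable fun m : Fin 3 →₀ ℕ => ‖MvPowerSeries.coeff m φ‖ * r ^ m.degree

/-- The derivation `φ ↦ ∑ χ_i ∂φ/∂w_i` given by the formal vector field `χ = ∑ χ_i ∂/∂w_i`. -/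
noncomputable def applyField (χ : Fin 3 → Series) (φ : Series) : Series :=
  ∑ i, χ i * MvPowerSeries.pderiv ℂ i φ

/-- `χ` is the infinitesimal generator of `g`: it has multiplicity at least `2`, and `g = exp χ`, that
is, `g_i = ∑ₙ χⁿ(w_i) / n!` for each coordinate `w_i`. As `χⁿ(w_i)` has order at least `n + 1`, only
the indices `n < |m|` can contribute to the coefficient at `m`. -/
def IsInfinitesimalGenerator (χ g : Fin 3 → Series) : Prop :=
  (∀ i, 2 ≤ (χ i).order) ∧
  ∀ (i : Fin 3) (m : Fin 3 →₀ ℕ), MvPowerSeries.coeff m (g i) =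
    ∑ n ∈ Finset.range (m.degree + 1),
      MvPowerSeries.coeff m ((applyField χ)^[n] (MvPowerSeries.X i)) / (n.factorial : ℂ)

/-- `χ'` is the saturation of `χ`: it is obtained from `χ` by dividing out the greatest common divisor
of the coefficients. It is unique up to multiplication by a unit. -/
def IsSaturation (χ χ' : Fin 3 → Series) : Prop :=
  (∃ h : Series, h ≠ 0 ∧ ∀ i, χ i = h * χ' i) ∧ ∀ d : Series, (∀ i, d ∣ χ' i) → IsUnit d

/-- A vector field is singular when it vanishes at the base point. -/
def IsSingular (χ : Fin 3 → Series) : Prop :=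
  ∀ i, MvPowerSeries.constantCoeff (χ i) = 0

/-- The matrix of the linear part. -/
noncomputable def linearPart (χ : Fin 3 → Series) : Matrix (Fin 3) (Fin 3) ℂ :=
  Matrix.of fun i j => MvPowerSeries.coeff (Finsupp.single j 1) (χ i)

/-- Tangency to the divisor with components `{w_i = 0}`, `i ∈ D`. -/
def IsTangent (D : Set (Fin 3)) (χ : Fin 3 → Series) : Prop :=
  ∀ i ∈ D, (MvPowerSeries.X i : Series) ∣ χ i

/-- Log-canonical saturated vector fields: tangent to `D`, and either regular or with a non-nilpotent
linear part. -/
def IsLogCanonical (D : Set (Fin 3)) (χ : Fin 3 → Series) : Prop :=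
  IsTangent D χ ∧ (¬ IsSingular χ ∨ ¬ IsNilpotent (linearPart χ))

/-- Radial vector fields: tangent to `D`, and the eigenvalues of the linear part, with multiplicity,
are positive integer multiples of one non-zero complex number. -/
def IsRadial (D : Set (Fin 3)) (χ : Fin 3 → Series) : Prop :=
  IsTangent D χ ∧ ∃ (l : ℂ) (n : Fin 3 → ℕ), l ≠ 0 ∧ (∀ i, 0 < n i) ∧
    (linearPart χ).charpoly = ∏ i, (Polynomial.X - Polynomial.C (l * (n i : ℂ)))

/-- Canonical (saturated) vector fields: log-canonical, but not radial. -/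
def IsCanonical (D : Set (Fin 3)) (χ : Fin 3 → Series) : Prop :=
  IsLogCanonical D χ ∧ ¬ IsRadial D χ

/-- The origin is an isolated common zero of `a₀, a₁, a₂`: the ideal that they generate contains a
power of the maximal ideal. -/
def IsIsolatedZero (a : Fin 3 → Series) : Prop :=
  ∃ N : ℕ, ∀ i, (MvPowerSeries.X i : Series) ^ N ∈ Ideal.span (Set.range a)

/-! ### Lifts to `X₄` -/

/-- `g` is the germ, at the point with coordinates `u` in the chart `c`, of the lift of `f` to `X₄`,
expanded in the coordinates centred at `u`: it fixes the point, and `π₀ ∘ (u + g) = f ∘ π₀(u + w)`.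
This is meant for points `u` above the origin; there `g` is determined by the equation. -/
def IsLift (f : Fin 3 → Series) (c : ChartFour) (u : Pt) (g : Fin 3 → Series) : Prop :=
  (∀ i, MvPowerSeries.constantCoeff (g i) = 0) ∧
  toBaseFour c (fun i => MvPowerSeries.C (u i) + g i) = fun i =>
    (f i).subst (toBaseFour c fun k => (MvPowerSeries.C (u k) + MvPowerSeries.X k : Series))

/-- `χ'` is the saturated infinitesimal generator of the lift of `f` to `X₄`, at the point with
coordinates `u` in the chart `c`, in the coordinates centred at `u`. -/
def IsSaturatedGenerator (f : Fin 3 → Series) (c : ChartFour) (u : Pt) (χ' : Fin 3 → Series) :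
    Prop :=
  ∃ g χ : Fin 3 → Series, IsLift f c u g ∧ IsInfinitesimalGenerator χ g ∧ IsSaturation χ χ'

/-- The saturated infinitesimal generator of the lift of `f` is singular at the point `p`. -/
def IsSingularPoint (f : Fin 3 → Series) (p : XFour) : Prop :=
  ∃ (c : ChartFour) (u : Pt) (χ : Fin 3 → Series),
    XFour.mk c u = p ∧ IsSaturatedGenerator f c u χ ∧ IsSingular χ

/-- The germ `(x + yz(y-z) + P, y + x(x²-z²) + Q, z + xz(y-z) + R)`. -/
noncomputable def exampleGerm (P Q R : Series) : Fin 3 → Series :=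
  let x : Series := MvPowerSeries.X 0
  let y : Series := MvPowerSeries.X 1
  let z : Series := MvPowerSeries.X 2
  ![x + y * z * (y - z) + P, y + x * (x ^ 2 - z ^ 2) + Q, z + x * z * (y - z) + R]

/-- The points `p₁, …, p₄`, in the `z`-chart. -/
noncomputable def p₁ : XFour := XFour.mk .z ![0, 0, 0]
noncomputable def p₂ : XFour := XFour.mk .z ![0, 1, 0]
noncomputable def p₃ : XFour := XFour.mk .z ![1, 1, 0]
noncomputable def p₄ : XFour := XFour.mk .z ![-1, 1, 0]

/-- The points `q₁, …, q₅`; the point `q₄` depends on the coefficient `r = R₀₄₀`. -/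
noncomputable def q₁ : XFour := XFour.mk .yxxx ![0, 0, 0]
noncomputable def q₂ : XFour := XFour.mk .yxxx ![0, 0, 1 / 2]
noncomputable def q₃ : XFour := XFour.mk .yxzz ![0, 0, 0]
noncomputable def q₄ (r : ℂ) : XFour := XFour.mk .yxzz ![0, 1 / (2 * r), 0]
noncomputable def q₅ : XFour := XFour.mk .yxzy ![0, 0, 0]

end BlowUpResolution

open BlowUpResolution

/-!
The proof rests on the fact that all nine chart maps of the modification are monomial and birational.
Let `χ` be the infinitesimal generator of the germ. If a formal vector field `ξ` in a chart lifts `χ`,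
that is, if `ξ (φ ∘ π₀) = (χ φ) ∘ π₀` for all power series `φ`, then the flow of `ξ` lifts the flow
of `χ` (`flow_map`). The chart maps are injective off the coordinate planes, so this is the only lift
(`toBaseFour_injective`), and generators are unique (`IsInfinitesimalGenerator.unique`). It is
therefore enough to lift `χ`.

The field `χ` agrees with `f - id` up to terms of order `5` (`exists_generator_exampleGerm`), so it is
the explicit cubic field `leadingPart` plus terms of order at least `4`. In each chart its lift is a
monomial times an explicit field `saturatedLift` (`derivation_toBaseFour`), in which the higher order
terms enter only through their strict transforms `b`. Of these, the only information needed is that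
over `p₅` the third one is congruent to `R₀₄₀` modulo the equation of the divisors that lie over `p₅`
(`exists_strictTransform`).

On the exceptional divisor the zeros of `saturatedLift` solve an elementary polynomial system. Its
solutions are determined over an arbitrary domain containing `ℂ` (`exists_mem_singularPoints`). Over
`ℂ` this gives the singular points. Applied to the residue ring of a prime ideal `p` in the ring of
power series at a point, it shows that if `p` contains the coefficients of `saturatedLift` and the
equations of the divisor, then `p` is maximal (`mem_singularPoints_and_X_mem`). This has two
consequences.

* The singularity is isolated on every component of the divisor. A common divisor of the coefficients
  that is not a unit would cut out a curve on a component, so `saturatedLift` is primitive and is the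
  saturation of the lift; it is unique up to a unit because the monomial is a product of units and
  primes (`exists_unit_mul_eq`).
* If the origin is an isolated fixed point of `f`, then a prime ideal that contains the coefficients
  of `saturatedLift` contains the equations of the divisor, because the fixed-point ideal is
  contained in the ideal of the coefficients of `χ` (`flow_X_sub_X_mem_span`); hence it is maximal,
  and the singularity is isolated.

It remains to compute the linear parts at the finitely many points (`isCanonicalMatrix_linearPart`):
being neither nilpotent nor radial is read off from the trace, the determinant and the trace of the
square, in a way that does not depend on multiplying the field by a unit.
-/

namespace BlowUpResolution
open MvPowerSeries

/-! ### Orders of power series and formal sums -/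

theorem natCast_le_order_iff {φ : Series} {N : ℕ} :
    (N : ℕ∞) ≤ φ.order ↔ ∀ m : Fin 3 →₀ ℕ, m.degree < N → coeff m φ = 0 :=
  ⟨fun h _ hm => coeff_of_lt_order (lt_of_lt_of_le (by exact_mod_cast hm) h),
    fun h => nat_le_order h⟩

theorem le_order_add {φ ψ : Series} {N : ℕ∞} (hφ : N ≤ φ.order) (hψ : N ≤ ψ.order) :
    N ≤ (φ + ψ).order :=
  (le_min hφ hψ).trans min_order_le_add

theorem le_order_sub {φ ψ : Series} {N : ℕ∞} (hφ : N ≤ φ.order) (hψ : N ≤ ψ.order) :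
    N ≤ (φ - ψ).order := by
  rw [sub_eq_add_neg]
  exact le_order_add hφ (by rwa [order_neg])

theorem le_order_sum {ι : Type*} (s : Finset ι) {φ : ι → Series} {N : ℕ∞}
    (h : ∀ i ∈ s, N ≤ (φ i).order) : N ≤ (∑ i ∈ s, φ i).order := by
  classical
  induction s using Finset.induction_on with
  | empty => simp
  | insert a s ha ih =>
    rw [Finset.sum_insert ha]
    exact le_order_add (h a (by simp)) (ih fun i hi => h i (by simp [hi]))

theorem le_order_mul_of_le {φ ψ : Series} {a b : ℕ∞} (hφ : a ≤ φ.order) (hψ : b ≤ ψ.order) :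
    a + b ≤ (φ * ψ).order :=
  (add_le_add hφ hψ).trans le_order_mul

/-- Two power series that agree to every order are equal. -/
theorem eq_of_forall_le_order_sub {φ ψ : Series} (h : ∀ N : ℕ, (N : ℕ∞) ≤ (φ - ψ).order) :
    φ = ψ := by
  ext m
  have := natCast_le_order_iff.1 (h (m.degree + 1)) m (Nat.lt_succ_self _)
  rwa [map_sub, sub_eq_zero] at this

theorem le_order_pderiv {φ : Series} {N : ℕ} (h : ((N + 1 : ℕ) : ℕ∞) ≤ φ.order) (i : Fin 3) :
    (N : ℕ∞) ≤ (pderiv ℂ i φ).order := by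
  refine natCast_le_order_iff.2 fun m hm => ?_
  rw [coeff_pderiv, natCast_le_order_iff.1 h _ (by simpa using hm), zero_mul]

/-- The sum of a sequence of power series whose `n`-th term has order at least `n`. Only the terms
with index at most `|m|` enter the coefficient at `m`. -/
noncomputable def formalSum (a : ℕ → Series) : Series :=
  fun m => ∑ n ∈ Finset.range (m.degree + 1), coeff m (a n)

theorem coeff_formalSum (a : ℕ → Series) (m : Fin 3 →₀ ℕ) :
    coeff m (formalSum a) = ∑ n ∈ Finset.range (m.degree + 1), coeff m (a n) := rfl

theorem le_order_formalSum_sub {a : ℕ → Series} (ha : ∀ n : ℕ, (n : ℕ∞) ≤ (a n).order) (N : ℕ) :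
    (N : ℕ∞) ≤ (formalSum a - ∑ n ∈ Finset.range N, a n).order := by
  refine natCast_le_order_iff.2 fun m hm => ?_
  rw [map_sub, coeff_formalSum, map_sum, sub_eq_zero]
  refine Finset.sum_subset (fun n hn => ?_) fun n _ hn => ?_
  · simp only [Finset.mem_range] at hn ⊢
    omega
  · simp only [Finset.mem_range, not_lt] at hn
    exact natCast_le_order_iff.1 (ha n) m (by omega)

theorem formalSum_mul {a b : ℕ → Series} (ha : ∀ n : ℕ, (n : ℕ∞) ≤ (a n).order)
    (hb : ∀ n : ℕ, (n : ℕ∞) ≤ (b n).order) :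
    formalSum a * formalSum b = formalSum fun n => ∑ k ∈ Finset.range (n + 1), a k * b (n - k) := by
  refine eq_of_forall_le_order_sub fun N => ?_
  have hab : ∀ i j : ℕ, ((i + j : ℕ) : ℕ∞) ≤ (a i * b j).order := fun i j => by
    rw [Nat.cast_add]
    exact le_order_mul_of_le (ha i) (hb j)
  have hc : ∀ n : ℕ, (n : ℕ∞) ≤ (∑ k ∈ Finset.range (n + 1), a k * b (n - k)).order := fun n =>
    le_order_sum _ fun k hk => by
      have h := hab k (n - k)
      rwa [Nat.add_sub_cancel' (by simpa [Nat.lt_succ_iff] using hk)] at h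
  have h1 := le_order_formalSum_sub ha N
  have h2 := le_order_formalSum_sub hb N
  have h3 := le_order_formalSum_sub hc N
  have h4 : (N : ℕ∞) ≤ ((∑ n ∈ Finset.range N, a n) * (∑ n ∈ Finset.range N, b n) -
      ∑ n ∈ Finset.range N, ∑ k ∈ Finset.range (n + 1), a k * b (n - k)).order := by
    rw [Finset.sum_range_diag_flip N fun i j => a i * b j, Finset.sum_mul_sum,
      ← Finset.sum_sub_distrib]
    refine le_order_sum _ fun i hi => ?_
    rw [← Finset.sum_range_add_sum_Ico _ (Nat.sub_le N i), add_sub_cancel_left]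
    refine le_order_sum _ fun j hj => le_trans ?_ (hab i j)
    rw [Finset.mem_Ico] at hj
    exact_mod_cast (by omega : N ≤ i + j)
  have h5 : formalSum a * formalSum b -
      formalSum (fun n => ∑ k ∈ Finset.range (n + 1), a k * b (n - k)) =
      (formalSum a - ∑ n ∈ Finset.range N, a n) * formalSum b +
      ((∑ n ∈ Finset.range N, a n) * (formalSum b - ∑ n ∈ Finset.range N, b n) +
      (((∑ n ∈ Finset.range N, a n) * (∑ n ∈ Finset.range N, b n) -
      ∑ n ∈ Finset.range N, ∑ k ∈ Finset.range (n + 1), a k * b (n - k)) -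
      (formalSum (fun n => ∑ k ∈ Finset.range (n + 1), a k * b (n - k)) -
      ∑ n ∈ Finset.range N, ∑ k ∈ Finset.range (n + 1), a k * b (n - k)))) := by ring
  rw [h5]
  refine le_order_add ?_ (le_order_add ?_ (le_order_sub h4 h3))
  · simpa using le_order_mul_of_le h1 (zero_le (a := (formalSum b).order))
  · simpa using le_order_mul_of_le (zero_le (a := (∑ n ∈ Finset.range N, a n).order)) h2

/-- A linear map that does not lower orders commutes with formal sums. -/
theorem map_formalSum (σ : Series →ₗ[ℂ] Series)
    (hσ : ∀ (N : ℕ) (φ : Series), (N : ℕ∞) ≤ φ.order → (N : ℕ∞) ≤ (σ φ).order)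
    {a : ℕ → Series} (ha : ∀ n : ℕ, (n : ℕ∞) ≤ (a n).order) :
    σ (formalSum a) = formalSum fun n => σ (a n) := by
  refine eq_of_forall_le_order_sub fun N => ?_
  have h1 := hσ N _ (le_order_formalSum_sub ha N)
  have h2 := le_order_formalSum_sub (a := fun n => σ (a n)) (fun n => hσ n _ (ha n)) N
  have h3 := le_order_sub h1 h2
  rwa [map_sub, map_sum, sub_sub_sub_cancel_right] at h3

/-! ### The flow of a formal vector field -/

/-- A formal vector field as a derivation. -/
noncomputable def fieldDerivation (χ : Fin 3 → Series) : Derivation ℂ Series Series :=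
  ∑ i, χ i • pderiv ℂ i

theorem fieldDerivation_apply (χ : Fin 3 → Series) (φ : Series) :
    fieldDerivation χ φ = applyField χ φ := by
  simp [fieldDerivation, applyField, Fin.sum_univ_three]

theorem applyField_X (χ : Fin 3 → Series) (i : Fin 3) : applyField χ (X i) = χ i := by
  simp only [applyField, pderiv_X, Pi.single_apply]
  simp

theorem le_order_applyField {χ : Fin 3 → Series} {a : ℕ}
    (hχ : ∀ i, ((a + 1 : ℕ) : ℕ∞) ≤ (χ i).order) {φ : Series} {N : ℕ}
    (hφ : (N : ℕ∞) ≤ φ.order) : ((N + a : ℕ) : ℕ∞) ≤ (applyField χ φ).order := by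
  refine le_order_sum _ fun i _ => ?_
  cases N with
  | zero =>
    have := le_order_mul_of_le (hχ i) (zero_le (a := (pderiv ℂ i φ).order))
    refine le_trans ?_ this
    rw [add_zero]
    exact_mod_cast (by omega : 0 + a ≤ a + 1)
  | succ N =>
    refine le_trans ?_ (le_order_mul_of_le (hχ i) (le_order_pderiv hφ i))
    exact_mod_cast (by omega : N + 1 + a ≤ a + 1 + N)

theorem le_order_applyField_iterate {χ : Fin 3 → Series} {a : ℕ}
    (hχ : ∀ i, ((a + 1 : ℕ) : ℕ∞) ≤ (χ i).order) {φ : Series} {N : ℕ}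
    (hφ : (N : ℕ∞) ≤ φ.order) (n : ℕ) :
    ((N + n * a : ℕ) : ℕ∞) ≤ ((applyField χ)^[n] φ).order := by
  induction n with
  | zero => simpa using hφ
  | succ n ih =>
    rw [Function.iterate_succ_apply', Nat.succ_mul, ← add_assoc]
    exact le_order_applyField hχ ih

/-- The `n`-th term `χⁿ φ / n!` of the exponential series. -/
noncomputable def flowTerm (χ : Fin 3 → Series) (φ : Series) (n : ℕ) : Series :=
  ((n.factorial : ℂ)⁻¹) • (applyField χ)^[n] φ

theorem le_order_flowTerm {χ : Fin 3 → Series} {a : ℕ}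
    (hχ : ∀ i, ((a + 1 : ℕ) : ℕ∞) ≤ (χ i).order) {φ : Series} {N : ℕ}
    (hφ : (N : ℕ∞) ≤ φ.order) (n : ℕ) :
    ((N + n * a : ℕ) : ℕ∞) ≤ (flowTerm χ φ n).order :=
  (le_order_applyField_iterate hχ hφ n).trans le_order_smul

theorem le_order_flowTerm_self {χ : Fin 3 → Series} (hχ : ∀ i, 2 ≤ (χ i).order) (φ : Series)
    (n : ℕ) : (n : ℕ∞) ≤ (flowTerm χ φ n).order := by
  simpa using le_order_flowTerm (a := 1) (N := 0) (φ := φ) (by exact_mod_cast hχ) (by simp) n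

/-- The action `φ ↦ φ ∘ exp χ = ∑ χⁿ φ / n!` of the time-one flow of `χ` on power series. -/
noncomputable def flow (χ : Fin 3 → Series) (φ : Series) : Series :=
  formalSum (flowTerm χ φ)

theorem isInfinitesimalGenerator_iff {χ g : Fin 3 → Series} :
    IsInfinitesimalGenerator χ g ↔ (∀ i, 2 ≤ (χ i).order) ∧ ∀ i, g i = flow χ (X i) := by
  refine and_congr_right fun _ => forall_congr' fun i => ?_
  rw [MvPowerSeries.ext_iff]
  refine forall_congr' fun m => ?_
  rw [flow, coeff_formalSum]
  simp [flowTerm, div_eq_inv_mul]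

theorem succ_smul_flowTerm (χ : Fin 3 → Series) (φ : Series) (n : ℕ) :
    ((n : ℂ) + 1) • flowTerm χ φ (n + 1) = fieldDerivation χ (flowTerm χ φ n) := by
  rw [flowTerm, flowTerm, Derivation.map_smul, fieldDerivation_apply, smul_smul,
    Function.iterate_succ_apply', Nat.factorial_succ]
  congr 1
  have : (n : ℂ) + 1 ≠ 0 := Nat.cast_add_one_ne_zero n
  push_cast
  field_simp

/-- The Leibniz rule for the divided powers of a derivation. -/
theorem flowTerm_mul (χ : Fin 3 → Series) (φ ψ : Series) (n : ℕ) :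
    flowTerm χ (φ * ψ) n = ∑ p ∈ Finset.HasAntidiagonal.antidiagonal n, flowTerm χ φ p.1 * flowTerm χ ψ p.2 := by
  induction n with
  | zero => simp [flowTerm]
  | succ n ih =>
    have hn : (n : ℂ) + 1 ≠ 0 := Nat.cast_add_one_ne_zero n
    apply smul_right_injective Series hn
    simp only
    rw [succ_smul_flowTerm, ih, map_sum]
    have h1 : ∀ p ∈ Finset.HasAntidiagonal.antidiagonal (n + 1),
        ((n : ℂ) + 1) • (flowTerm χ φ p.1 * flowTerm χ ψ p.2) =
        ((p.1 : ℂ) • flowTerm χ φ p.1) * flowTerm χ ψ p.2 +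
        flowTerm χ φ p.1 * ((p.2 : ℂ) • flowTerm χ ψ p.2) := by
      intro p hp
      rw [Finset.HasAntidiagonal.mem_antidiagonal] at hp
      rw [smul_mul_assoc, mul_smul_comm, ← add_smul]
      congr 1
      exact_mod_cast hp.symm
    rw [Finset.smul_sum, Finset.sum_congr rfl h1, Finset.sum_add_distrib,
      Finset.Nat.sum_antidiagonal_succ, Finset.Nat.sum_antidiagonal_succ']
    simp only [Nat.cast_zero, zero_smul, zero_mul, mul_zero, zero_add, Nat.cast_add,
      Nat.cast_one, succ_smul_flowTerm, ← Finset.sum_add_distrib, Derivation.leibniz, smul_eq_mul]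
    exact Finset.sum_congr rfl fun p _ => by ring

theorem flow_mul {χ : Fin 3 → Series} (hχ : ∀ i, 2 ≤ (χ i).order) (φ ψ : Series) :
    flow χ (φ * ψ) = flow χ φ * flow χ ψ := by
  rw [flow, flow, flow, formalSum_mul (le_order_flowTerm_self hχ φ) (le_order_flowTerm_self hχ ψ)]
  congr 1
  funext n
  rw [flowTerm_mul, Finset.Nat.sum_antidiagonal_eq_sum_range_succ_mk]

theorem flow_C_add (χ : Fin 3 → Series) (c : ℂ) (φ : Series) :
    flow χ (C c + φ) = C c + flow χ φ := by
  have h : ∀ n, flowTerm χ (C c + φ) n = (if n = 0 then C c else 0) + flowTerm χ φ n := by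
    intro n
    cases n with
    | zero => simp [flowTerm]
    | succ n =>
      have : applyField χ (C c + φ) = applyField χ φ := by simp [applyField]
      simp [flowTerm, Function.iterate_succ_apply, this]
  ext m
  simp only [flow, map_add, coeff_formalSum, h, Finset.sum_add_distrib]
  congr 1
  rw [Finset.sum_eq_single 0] <;> simp +contextual

/-- If `χ'` is the lift of `χ` along `σ`, then the flow of `χ'` is the lift of the flow of `χ`. -/
theorem flow_map (σ : Series →ₗ[ℂ] Series)
    (hσ : ∀ (N : ℕ) (φ : Series), (N : ℕ∞) ≤ φ.order → (N : ℕ∞) ≤ (σ φ).order)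
    {χ χ' : Fin 3 → Series} (hχ : ∀ i, 2 ≤ (χ i).order)
    (h : ∀ φ, applyField χ' (σ φ) = σ (applyField χ φ)) (φ : Series) :
    flow χ' (σ φ) = σ (flow χ φ) := by
  rw [flow, flow, map_formalSum σ hσ (le_order_flowTerm_self hχ φ)]
  congr 1
  funext n
  rw [flowTerm, flowTerm, map_smul]
  congr 1
  exact ((Function.Semiconj.iterate_right (f := σ) (ga := applyField χ) (gb := applyField χ')
    (fun φ => (h φ).symm) n) φ).symm

/-! ### Existence and uniqueness of the infinitesimal generator -/

/-- `exp χ` differs from `id + χ` only by terms of order at least `2a + 1`, where `a + 1` is the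
multiplicity of `χ`. -/
theorem le_order_flow_sub_linear {χ : Fin 3 → Series} {a : ℕ} (ha : 1 ≤ a)
    (hχ : ∀ i, ((a + 1 : ℕ) : ℕ∞) ≤ (χ i).order) (i : Fin 3) :
    ((2 * a + 1 : ℕ) : ℕ∞) ≤ (flow χ (X i) - X i - χ i).order := by
  have hX : ((1 : ℕ) : ℕ∞) ≤ (X i : Series).order := by
    rw [Nat.cast_one, one_le_order_iff_constCoeff_eq_zero]
    exact constantCoeff_X i
  have h0 : ∀ n : ℕ, (n : ℕ∞) ≤ (flowTerm χ (X i) n).order := fun n =>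
    le_trans (by exact_mod_cast (by nlinarith : n ≤ 1 + n * a)) (le_order_flowTerm hχ hX n)
  have h1 := le_order_formalSum_sub h0 (2 * a + 1)
  have h2 : flow χ (X i) - X i - χ i =
      (formalSum (flowTerm χ (X i)) - ∑ n ∈ Finset.range (2 * a + 1), flowTerm χ (X i) n) +
      ∑ n ∈ Finset.Ico 2 (2 * a + 1), flowTerm χ (X i) n := by
    rw [← Finset.sum_range_add_sum_Ico _ (by omega : 2 ≤ 2 * a + 1), Finset.sum_range_succ,
      Finset.sum_range_one, flow]
    have e0 : flowTerm χ (X i) 0 = X i := by simp [flowTerm]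
    have e1 : flowTerm χ (X i) 1 = χ i := by simp [flowTerm, applyField_X]
    rw [e0, e1]
    ring
  rw [h2]
  refine le_order_add h1 (le_order_sum _ fun n hn => le_trans ?_ (le_order_flowTerm hχ hX n))
  rw [Finset.mem_Ico] at hn
  exact_mod_cast (by nlinarith : 2 * a + 1 ≤ 1 + n * a)

theorem applyField_sub_field (χ χ' : Fin 3 → Series) (φ : Series) :
    applyField χ φ - applyField χ' φ = applyField (fun i => χ i - χ' i) φ := by
  simp only [applyField, sub_mul, Finset.sum_sub_distrib]

theorem applyField_sub (χ : Fin 3 → Series) (φ ψ : Series) :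
    applyField χ (φ - ψ) = applyField χ φ - applyField χ ψ := by
  simp only [← fieldDerivation_apply, map_sub]

/-- Vector fields that agree up to order `N` have flows which differ, up to order `N + 1`, by the
difference of the fields: the correction `exp χ - id - χ` is contracting in `χ`. -/
theorem le_order_flow_sub_flow {χ χ' : Fin 3 → Series} (hχ : ∀ i, 2 ≤ (χ i).order)
    (hχ' : ∀ i, 2 ≤ (χ' i).order) {N : ℕ} (h : ∀ i, (N : ℕ∞) ≤ (χ i - χ' i).order) (i : Fin 3) :
    ((N + 1 : ℕ) : ℕ∞) ≤ ((flow χ (X i) - flow χ' (X i)) - (χ i - χ' i)).order := by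
  have hX : ((1 : ℕ) : ℕ∞) ≤ (X i : Series).order := by
    rw [Nat.cast_one, one_le_order_iff_constCoeff_eq_zero]
    exact constantCoeff_X i
  have key : ∀ n : ℕ, ((N + n : ℕ) : ℕ∞) ≤
      ((applyField χ)^[n + 1] (X i) - (applyField χ')^[n + 1] (X i)).order := by
    intro n
    induction n with
    | zero => simpa [applyField_X] using h i
    | succ n ih =>
      rw [Function.iterate_succ_apply' _ (n + 1), Function.iterate_succ_apply' _ (n + 1),
        ← sub_add_sub_cancel _ (applyField χ ((applyField χ')^[n + 1] (X i))),
        ← applyField_sub, applyField_sub_field]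
      refine le_order_add (le_order_applyField (a := 1) (by exact_mod_cast hχ) ih) ?_
      refine le_order_sum _ fun j _ => ?_
      have h1 := le_order_applyField_iterate (a := 1) (by exact_mod_cast hχ') hX (n + 1)
      have h2 := le_order_mul_of_le (h j) (le_order_pderiv
        (N := n + 1) (le_trans (by exact_mod_cast (by omega)) h1) j)
      exact_mod_cast h2
  refine natCast_le_order_iff.2 fun m hm => ?_
  rw [map_sub, map_sub, flow, flow, coeff_formalSum, coeff_formalSum, ← Finset.sum_sub_distrib]
  simp only [← map_sub]
  rw [sub_eq_zero]
  by_cases hm0 : m.degree = 0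
  · have h1 : (1 : ℕ∞) ≤ (χ i - χ' i).order :=
      le_order_sub (le_trans (by norm_num) (hχ i)) (le_trans (by norm_num) (hχ' i))
    rw [(natCast_le_order_iff (N := 1)).1 (by exact_mod_cast h1) m (by omega), hm0]
    simp [flowTerm]
  · rw [Finset.sum_eq_single 1]
    · simp [flowTerm, applyField_X]
    · intro n _ hn
      match n with
      | 0 => simp [flowTerm]
      | 1 => exact absurd rfl hn
      | n + 2 =>
        rw [flowTerm, flowTerm, ← smul_sub, coeff_smul,
          natCast_le_order_iff.1 (key (n + 1)) m (by omega), mul_zero]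
    · intro h1
      simp only [Finset.mem_range, not_lt] at h1
      omega

theorem IsInfinitesimalGenerator.unique {χ χ' g : Fin 3 → Series}
    (h : IsInfinitesimalGenerator χ g) (h' : IsInfinitesimalGenerator χ' g) : χ = χ' := by
  rw [isInfinitesimalGenerator_iff] at h h'
  have key : ∀ (N : ℕ) (i : Fin 3), (N : ℕ∞) ≤ (χ i - χ' i).order := by
    intro N
    induction N with
    | zero => simp
    | succ N ih =>
      intro i
      have := le_order_flow_sub_flow h.1 h'.1 ih i
      rwa [← h.2, ← h'.2, sub_self, zero_sub, order_neg] at this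
  exact funext fun i => eq_of_forall_le_order_sub fun N => key N i

/-- The iteration `χ ↦ f - (exp χ - χ)`, whose fixed point is the infinitesimal generator of `f`. -/
noncomputable def generatorApprox (f : Fin 3 → Series) : ℕ → Fin 3 → Series
  | 0 => 0
  | k + 1 => fun i => f i - flow (generatorApprox f k) (X i) + generatorApprox f k i

theorem exists_isInfinitesimalGenerator {f : Fin 3 → Series} (hf : ∀ i, 2 ≤ (f i - X i).order) :
    ∃ χ, IsInfinitesimalGenerator χ f := by
  set c := generatorApprox f with hc
  have hstep : ∀ k i, c (k + 1) i = f i - flow (c k) (X i) + c k i := fun k i => rfl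
  have hord : ∀ k i, 2 ≤ (c k i).order := by
    intro k
    induction k with
    | zero => intro i; simp [hc, generatorApprox]
    | succ k ih =>
      intro i
      have h1 := le_order_flow_sub_linear (a := 1) le_rfl (by exact_mod_cast ih) i
      have h2 := le_order_sub (hf i) (le_trans (by norm_num) h1)
      convert h2 using 2
      rw [hstep]
      ring
  have hdiff : ∀ (k : ℕ) i, (k : ℕ∞) ≤ (c (k + 1) i - c k i).order := by
    intro k
    induction k with
    | zero => simp
    | succ k ih =>
      intro i
      have h1 := le_order_flow_sub_flow (hord (k + 1)) (hord k) ih i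
      have h2 : c (k + 1 + 1) i - c (k + 1) i = -((flow (c (k + 1)) (X i) - flow (c k) (X i)) -
          (c (k + 1) i - c k i)) := by
        rw [hstep (k + 1), hstep k]
        ring
      rwa [h2, order_neg]
  set χ : Fin 3 → Series := fun i => formalSum fun n => c (n + 1) i - c n i with hχ
  have hlim : ∀ (N : ℕ) i, (N : ℕ∞) ≤ (χ i - c N i).order := by
    intro N i
    have h1 := le_order_formalSum_sub (fun n => hdiff n i) N
    rw [Finset.sum_range_sub (fun n => c n i)] at h1
    have h0 : c 0 i = 0 := rfl
    rwa [h0, sub_zero] at h1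
  have hord' : ∀ i, 2 ≤ (χ i).order := fun i => by
    have := le_order_add (hlim 2 i) (hord 2 i)
    rwa [sub_add_cancel] at this
  refine ⟨χ, isInfinitesimalGenerator_iff.2 ⟨hord', fun i => ?_⟩⟩
  refine eq_of_forall_le_order_sub fun N => ?_
  have h1 := le_order_flow_sub_flow hord' (hord N) (hlim N) i
  have h2 : f i - flow χ (X i) = (c (N + 1) i - c N i) -
      (((flow χ (X i) - flow (c N) (X i)) - (χ i - c N i)) + (χ i - c N i)) := by
    rw [hstep]
    ring
  rw [h2]
  exact le_order_sub (hdiff N i)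
    (le_order_add (le_trans (by exact_mod_cast Nat.le_succ N) h1) (hlim N i))

/-- The fixed-point ideal of `exp χ` is contained in the ideal of the coefficients of `χ`. -/
theorem flow_X_sub_X_mem_span {χ : Fin 3 → Series} (hχ : ∀ i, 2 ≤ (χ i).order) (i : Fin 3) :
    flow χ (X i) - X i ∈ Ideal.span (Set.range χ) := by
  set b : Fin 3 → ℕ → Series := fun j n =>
    (((n + 1).factorial : ℂ)⁻¹) • pderiv ℂ j ((applyField χ)^[n] (X i)) with hb
  have hX : ((1 : ℕ) : ℕ∞) ≤ (X i : Series).order := by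
    rw [Nat.cast_one, one_le_order_iff_constCoeff_eq_zero]
    exact constantCoeff_X i
  have hbo : ∀ (j : Fin 3) (n : ℕ), (n : ℕ∞) ≤ (b j n).order := fun j n =>
    (le_order_pderiv (N := n) (by
      have := le_order_applyField_iterate (a := 1) (by exact_mod_cast hχ) hX n
      rwa [mul_one, add_comm] at this) j).trans le_order_smul
  have hsum : ∀ n, flowTerm χ (X i) (n + 1) = ∑ j, χ j * b j n := by
    intro n
    rw [flowTerm, Function.iterate_succ_apply', applyField, Finset.smul_sum]
    exact Finset.sum_congr rfl fun j _ => by rw [hb, mul_smul_comm]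
  have key : flow χ (X i) - X i = ∑ j, χ j * formalSum (b j) := by
    refine eq_of_forall_le_order_sub fun N => ?_
    have h1 := le_order_formalSum_sub (le_order_flowTerm_self hχ (X i)) (N + 1)
    have h2 : (N : ℕ∞) ≤
        (∑ j, χ j * (formalSum (b j) - ∑ n ∈ Finset.range N, b j n)).order :=
      le_order_sum _ fun j _ => by
        simpa using le_order_mul_of_le (zero_le (a := (χ j).order)) (le_order_formalSum_sub (hbo j) N)
    have h3 := le_order_sub (le_trans (by exact_mod_cast Nat.le_succ N) h1) h2
    convert h3 using 2
    rw [Finset.sum_range_succ' (flowTerm χ (X i)), Finset.sum_congr rfl fun n _ => hsum n]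
    have e0 : flowTerm χ (X i) 0 = X i := by simp [flowTerm]
    rw [e0, flow, Finset.sum_comm]
    simp only [mul_sub, Finset.sum_sub_distrib, Finset.mul_sum]
    ring
  rw [key]
  exact Ideal.sum_mem _ fun j _ => Ideal.mul_mem_right _ _ (Ideal.subset_span ⟨j, rfl⟩)

/-! ### Substitutions and lifts of vector fields -/

/-- Division with remainder by the three coordinates, respecting orders. -/
theorem exists_eq_sum_X_mul {φ : Series} {N : ℕ} (h : ((N + 1 : ℕ) : ℕ∞) ≤ φ.order) :
    ∃ ψ : Fin 3 → Series, (∀ i, (N : ℕ∞) ≤ (ψ i).order) ∧ φ = ∑ i, X i * ψ i := by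
  classical
  -- a monomial goes into the summand of the first coordinate that it contains
  set P : Fin 3 → (Fin 3 →₀ ℕ) → Prop := fun i m => m i ≠ 0 ∧ ∀ j < i, m j = 0 with hP
  set part : Fin 3 → Series := fun i m => if P i m then coeff m φ else 0 with hpart
  have hc : ∀ i m, coeff m (part i) = if P i m then coeff m φ else 0 := fun _ _ => rfl
  have hdvd : ∀ i, (X i : Series) ∣ part i := fun i =>
    X_dvd_iff.2 fun m hm => by rw [hc, if_neg fun hm' => hm'.1 hm]
  choose ψ hψ using hdvd
  refine ⟨ψ, fun i => ?_, ?_⟩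
  · have h1 : ((N + 1 : ℕ) : ℕ∞) ≤ (part i).order := by
      rw [natCast_le_order_iff] at h ⊢
      intro m hm
      rw [hc, h m hm, ite_self]
    have hX : (X i : Series).order = 1 := by
      rw [X, order_monomial_of_ne_zero one_ne_zero]
      simp
    rw [hψ i, order_mul, hX, Nat.cast_add, Nat.cast_one, add_comm] at h1
    exact (ENat.add_le_add_iff_left (by simp)).1 h1
  · simp only [← hψ]
    ext m
    rw [map_sum]
    simp only [hc, Fin.sum_univ_three, hP]
    by_cases h0 : m 0 = 0 <;> by_cases h1 : m 1 = 0 <;> by_cases h2 : m 2 = 0 <;>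
      simp [h0, h1, h2, Fin.forall_fin_succ, Fin.lt_def]
    refine natCast_le_order_iff.1 h m ?_
    simp [Finsupp.degree_eq_sum, Fin.sum_univ_three, h0, h1, h2]

theorem exists_eq_C_add_sum_X_mul (φ : Series) :
    ∃ ψ : Fin 3 → Series, φ = C (constantCoeff φ) + ∑ i, X i * ψ i := by
  have h : ((0 + 1 : ℕ) : ℕ∞) ≤ (φ - C (constantCoeff φ)).order := by
    rw [zero_add, Nat.cast_one, one_le_order_iff_constCoeff_eq_zero]
    simp
  obtain ⟨ψ, -, hψ⟩ := exists_eq_sum_X_mul h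
  exact ⟨ψ, by rw [← hψ]; ring⟩

theorem algHom_C (σ : Series →ₐ[ℂ] Series) (c : ℂ) : σ (C c) = C c := by
  have h : (C c : Series) = algebraMap ℂ Series c := rfl
  rw [h, AlgHom.commutes]

theorem le_order_algHom {σ : Series →ₐ[ℂ] Series} (hσ : ∀ i, 1 ≤ (σ (X i)).order) (N : ℕ) :
    ∀ φ : Series, (N : ℕ∞) ≤ φ.order → (N : ℕ∞) ≤ (σ φ).order := by
  induction N with
  | zero => simp
  | succ N ih =>
    intro φ hφ
    obtain ⟨ψ, hψ, rfl⟩ := exists_eq_sum_X_mul hφ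
    rw [map_sum]
    refine le_order_sum _ fun i _ => ?_
    rw [map_mul, add_comm N 1, Nat.cast_add, Nat.cast_one]
    exact le_order_mul_of_le (hσ i) (ih _ (hψ i))

theorem constantCoeff_algHom {σ : Series →ₐ[ℂ] Series} (hσ : ∀ i, 1 ≤ (σ (X i)).order)
    (φ : Series) : constantCoeff (σ φ) = constantCoeff φ := by
  obtain ⟨ψ, hψ⟩ := exists_eq_C_add_sum_X_mul φ
  have h : ∀ i, constantCoeff (σ (X i)) = 0 := fun i =>
    one_le_order_iff_constCoeff_eq_zero.1 (hσ i)
  conv_lhs => rw [hψ]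
  simp [algHom_C, h]

/-- The lift of a vector field is characterised by its values on the coordinates. The difference of
the two sides is a derivation along `σ` that kills the coordinates; expanding `φ` along the
coordinates shows that its values have arbitrarily high order. -/
theorem applyField_algHom {σ : Series →ₐ[ℂ] Series} (hσ : ∀ i, 1 ≤ (σ (X i)).order)
    {χ χ' : Fin 3 → Series} (h : ∀ i, applyField χ' (σ (X i)) = σ (χ i)) (φ : Series) :
    applyField χ' (σ φ) = σ (applyField χ φ) := by
  refine eq_of_forall_le_order_sub fun N => ?_
  simp only [← fieldDerivation_apply] at h ⊢
  induction N generalizing φ with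
  | zero => simp
  | succ N ih =>
    obtain ⟨ψ, hψ⟩ := exists_eq_C_add_sum_X_mul φ
    have hC : ∀ (χ : Fin 3 → Series) c, fieldDerivation χ (C c) = 0 := fun χ c =>
      (fieldDerivation χ).map_algebraMap c
    have hX : ∀ i, fieldDerivation χ (X i) = χ i := fun i => by
      rw [fieldDerivation_apply, applyField_X]
    have key : fieldDerivation χ' (σ φ) - σ (fieldDerivation χ φ) =
        ∑ i, σ (X i) * (fieldDerivation χ' (σ (ψ i)) - σ (fieldDerivation χ (ψ i))) := by
      conv_lhs => rw [hψ]
      simp only [map_add, map_sum, map_mul, algHom_C, hC, Derivation.leibniz, smul_eq_mul, h, hX,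
        zero_add, ← Finset.sum_sub_distrib]
      exact Finset.sum_congr rfl fun i _ => by ring
    rw [key]
    refine le_order_sum _ fun i _ => ?_
    rw [add_comm N 1, Nat.cast_add, Nat.cast_one]
    exact le_order_mul_of_le (hσ i) (ih _)

/-- The strict transform of a power series of order at least `n` under a substitution for which all
coordinates become multiples of `σ (X j)`. -/
theorem exists_algHom_eq_pow_mul (σ : Series →ₐ[ℂ] Series) (j : Fin 3)
    (hσ : ∀ i, σ (X j) ∣ σ (X i)) (n : ℕ) :
    ∀ φ : Series, (n : ℕ∞) ≤ φ.order → ∃ b, σ φ = σ (X j) ^ n * b := by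
  choose s hs using hσ
  induction n with
  | zero => exact fun φ _ => ⟨σ φ, by simp⟩
  | succ n ih =>
    intro φ hφ
    obtain ⟨ψ, hψ, rfl⟩ := exists_eq_sum_X_mul hφ
    choose b hb using fun i => ih (ψ i) (hψ i)
    refine ⟨∑ i, s i * b i, ?_⟩
    rw [map_sum, Finset.mul_sum]
    refine Finset.sum_congr rfl fun i _ => ?_
    rw [map_mul, hb, hs]
    ring

/-- If moreover the quotients `σ (X i) / σ (X 1)`, `i ≠ 1`, and `σ (X 1)` are multiples of `e`, then
the strict transform is congruent modulo `e` to the coefficient of `yⁿ`. -/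
theorem exists_algHom_eq_pow_mul_coeff_add (σ : Series →ₐ[ℂ] Series) (e : Series)
    (he : e ∣ σ (X 1)) (hσ : ∀ i, i ≠ 1 → ∃ t, σ (X i) = σ (X 1) * (e * t)) (n : ℕ) :
    ∀ φ : Series, (n : ℕ∞) ≤ φ.order →
      ∃ g, σ φ = σ (X 1) ^ n * (C (coeff (Finsupp.single 1 n) φ) + e * g) := by
  obtain ⟨t₁, ht₁⟩ := he
  obtain ⟨t₀, ht₀⟩ := hσ 0 (by decide)
  obtain ⟨t₂, ht₂⟩ := hσ 2 (by decide)
  induction n with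
  | zero =>
    intro φ _
    obtain ⟨ψ, hψ⟩ := exists_eq_C_add_sum_X_mul φ
    refine ⟨t₁ * (e * t₀ * σ (ψ 0) + σ (ψ 1) + e * t₂ * σ (ψ 2)), ?_⟩
    conv_lhs => rw [hψ]
    simp only [map_add, map_mul, algHom_C, Fin.sum_univ_three, ht₀, ht₂,
      Finsupp.single_zero, coeff_zero_eq_constantCoeff]
    linear_combination (e * t₀ * σ (ψ 0) + σ (ψ 1) + e * t₂ * σ (ψ 2)) * ht₁
  | succ n ih =>
    intro φ hφ
    obtain ⟨ψ, hψ, rfl⟩ := exists_eq_sum_X_mul hφ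
    choose g hg using fun i => ih (ψ i) (hψ i)
    have hcoeff : coeff (Finsupp.single 1 (n + 1)) (∑ i, X i * ψ i) =
        coeff (Finsupp.single 1 n) (ψ 1) := by
      have h0 : coeff (Finsupp.single 1 (n + 1)) (X 0 * ψ 0) = 0 :=
        X_dvd_iff.1 (dvd_mul_right _ _) _ (by simp)
      have h2 : coeff (Finsupp.single 1 (n + 1)) (X 2 * ψ 2) = 0 :=
        X_dvd_iff.1 (dvd_mul_right _ _) _ (by simp)
      have h1 : coeff (Finsupp.single 1 (n + 1)) (X 1 * ψ 1) =
          coeff (Finsupp.single 1 n) (ψ 1) := by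
        rw [add_comm n 1, Finsupp.single_add, X, coeff_add_monomial_mul, one_mul]
      rw [Fin.sum_univ_three, map_add, map_add, h0, h1, h2, zero_add, add_zero]
    rw [hcoeff]
    refine ⟨t₀ * (C (coeff (Finsupp.single 1 n) (ψ 0)) + e * g 0) + g 1 +
      t₂ * (C (coeff (Finsupp.single 1 n) (ψ 2)) + e * g 2), ?_⟩
    rw [Fin.sum_univ_three, map_add, map_add, map_mul, map_mul, map_mul, hg, hg, hg, ht₀, ht₂]
    ring

/-- The substitution of power series without constant term. -/
noncomputable def substHom (s : Fin 3 → Series) (hs : ∀ i, constantCoeff (s i) = 0) :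
    Series →ₐ[ℂ] Series :=
  substAlgHom (hasSubst_of_constantCoeff_zero hs)

theorem substHom_X (s : Fin 3 → Series) (hs : ∀ i, constantCoeff (s i) = 0) (i : Fin 3) :
    substHom s hs (X i) = s i :=
  substAlgHom_X _ i

theorem le_order_substHom_X (s : Fin 3 → Series) (hs : ∀ i, constantCoeff (s i) = 0) (i : Fin 3) :
    1 ≤ (substHom s hs (X i)).order := by
  rw [substHom_X, one_le_order_iff_constCoeff_eq_zero, hs]

theorem substHom_apply (s : Fin 3 → Series) (hs : ∀ i, constantCoeff (s i) = 0) (φ : Series) :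
    substHom s hs φ = φ.subst s :=
  substAlgHom_apply _ φ

/-! ### Saturations -/

theorem X_dvd_iff_one_le_weightedOrder (i : Fin 3) (φ : Series) :
    X i ∣ φ ↔ 1 ≤ weightedOrder (Pi.single i 1) φ := by
  classical
  have hw : ∀ m : Fin 3 →₀ ℕ, Finsupp.weight (Pi.single i 1 : Fin 3 → ℕ) m = m i := fun m => by
    rw [Finsupp.weight_apply, Finsupp.sum_fintype _ _ (by simp)]
    simp [Pi.single_apply]
  rw [X_dvd_iff]
  constructor
  · intro h
    refine le_weightedOrder _ fun m hm => h m ?_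
    rw [hw] at hm
    exact Nat.lt_one_iff.1 (by exact_mod_cast hm)
  · intro h m hm
    refine coeff_eq_zero_of_lt_weightedOrder (Pi.single i 1) (lt_of_lt_of_le ?_ h)
    rw [hw, hm]
    exact_mod_cast Nat.zero_lt_one

theorem prime_X (i : Fin 3) : Prime (X i : Series) := by
  refine ⟨?_, ?_, fun φ ψ h => ?_⟩
  · intro h
    simpa [h] using coeff_index_single_self_X (R := ℂ) i
  · rw [isUnit_iff_constantCoeff, constantCoeff_X]
    exact not_isUnit_zero
  · rw [X_dvd_iff_one_le_weightedOrder, weightedOrder_mul, Order.one_le_iff_ne_zero, ne_eq,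
      add_eq_zero, not_and_or] at h
    simpa only [X_dvd_iff_one_le_weightedOrder, Order.one_le_iff_ne_zero] using h

theorem not_X_dvd_X {i j : Fin 3} (h : i ≠ j) : ¬ (X i : Series) ∣ X j := fun hd => by
  simpa using X_dvd_iff.1 hd (Finsupp.single j 1) (by simp [h])

/-- The coefficients have no common divisor. -/
def IsPrimitiveField (χ : Fin 3 → Series) : Prop :=
  ∀ d : Series, (∀ i, d ∣ χ i) → IsUnit d

theorem exists_eq_mul_of_pow_mul_eq {χ χ' : Fin 3 → Series} (hχ' : IsPrimitiveField χ')
    {w : Series} (hw : IsUnit w ∨ Prime w) (n : ℕ) :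
    ∀ h, (∀ i, w ^ n * χ i = h * χ' i) → ∃ h', ∀ i, χ i = h' * χ' i := by
  induction n with
  | zero => exact fun h hh => ⟨h, by simpa using hh⟩
  | succ n ih =>
    intro h hh
    have hdvd : w ∣ h := by
      by_contra hn
      have hp : Prime w := hw.resolve_left fun hu => hn hu.dvd
      refine hp.not_isUnit (hχ' w fun i => (hp.dvd_or_dvd ?_).resolve_left hn)
      rw [← hh i, pow_succ', mul_assoc]
      exact dvd_mul_right _ _
    have hw0 : w ≠ 0 := hw.elim IsUnit.ne_zero Prime.ne_zero
    obtain ⟨h', rfl⟩ := hdvd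
    refine ih h' fun i => mul_left_cancel₀ hw0 ?_
    rw [← mul_assoc, ← mul_assoc, ← pow_succ', hh i]

/-- If a monomial in units and primes times a primitive field `χ` has the saturation `χ'`, then `χ`
and `χ'` differ by a unit. This is the part of unique factorisation that is needed here. -/
theorem exists_unit_mul_eq {χ χ' : Fin 3 → Series} (hχ : IsPrimitiveField χ)
    (hχ' : IsPrimitiveField χ') {w : Fin 3 → Series} (hw : ∀ i, IsUnit (w i) ∨ Prime (w i))
    (a : Fin 3 → ℕ) {h : Series}
    (hh : ∀ i, w 0 ^ a 0 * w 1 ^ a 1 * w 2 ^ a 2 * χ i = h * χ' i) :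
    ∃ v, IsUnit v ∧ ∀ i, χ' i = v * χ i := by
  obtain ⟨h₀, hh₀⟩ := exists_eq_mul_of_pow_mul_eq
    (χ := fun i => w 1 ^ a 1 * (w 2 ^ a 2 * χ i)) hχ' (hw 0) (a 0) h
    fun i => by rw [← hh]; ring
  obtain ⟨h₁, hh₁⟩ := exists_eq_mul_of_pow_mul_eq (χ := fun i => w 2 ^ a 2 * χ i) hχ' (hw 1)
    (a 1) h₀ hh₀
  obtain ⟨h₂, hh₂⟩ := exists_eq_mul_of_pow_mul_eq hχ' (hw 2) (a 2) h₁ hh₁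
  obtain ⟨v, hv⟩ := hχ h₂ fun i => ⟨_, hh₂ i⟩
  refine ⟨((v⁻¹ : Seriesˣ) : Series), Units.isUnit _, fun i => ?_⟩
  rw [hh₂, ← hv, Units.inv_mul_cancel_left]

/-- A vector field with an isolated singularity on the plane `w_i = 0` is primitive: a common
divisor without constant term would, on this plane, divide powers of both remaining coordinates. -/
theorem isPrimitiveField_of_mem_radical {χ : Fin 3 → Series} (i : Fin 3)
    (h : ∀ k, (X k : Series) ∈ (Ideal.span (Set.range χ) ⊔ Ideal.span {X i}).radical) :
    IsPrimitiveField χ := by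
  classical
  intro d hd
  have hs : ∀ k, constantCoeff ((fun k => if k = i then 0 else X k : Fin 3 → Series) k) = 0 :=
    fun k => by
      by_cases hk : k = i <;> simp [hk]
  set ε := substHom _ hs with hε
  have hεX : ∀ k, ε (X k) = if k = i then 0 else X k := fun k => substHom_X _ hs k
  have key : ∀ k, k ≠ i → ∃ N, ε d ∣ X k ^ N := by
    intro k hk
    obtain ⟨N, hN⟩ := h k
    have hle : Ideal.span (Set.range χ) ⊔ Ideal.span {X i} ≤ Ideal.span {d, X i} := by
      refine sup_le (Ideal.span_le.2 ?_) (Ideal.span_mono (by simp))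
      rintro _ ⟨j, rfl⟩
      obtain ⟨b, hb⟩ := hd j
      rw [hb]
      exact Ideal.mul_mem_right _ _ (Ideal.subset_span (by simp))
    obtain ⟨a, b, hab⟩ := Ideal.mem_span_pair.1 (hle hN)
    refine ⟨N, ε a, ?_⟩
    have := congrArg ε hab
    simp only [map_add, map_mul, map_pow, hεX, if_true, if_neg hk, mul_zero, add_zero] at this
    rw [← this, mul_comm]
  have hunit : IsUnit (ε d) := by
    obtain ⟨k, l, hki, hli, hkl⟩ : ∃ k l : Fin 3, k ≠ i ∧ l ≠ i ∧ k ≠ l := by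
      clear * -
      revert i
      decide
    obtain ⟨N, hN⟩ := key k hki
    obtain ⟨N', hN'⟩ := key l hli
    obtain ⟨a, -, ha⟩ := (dvd_prime_pow (prime_X k) N).1 hN
    rcases Nat.eq_zero_or_pos a with rfl | hpos
    · exact associated_one_iff_isUnit.1 (by simpa using ha)
    · have h1 : (X k : Series) ∣ ε d := (dvd_pow_self _ hpos.ne').trans ha.symm.dvd
      exact absurd ((prime_X k).dvd_of_dvd_pow (h1.trans hN')) (not_X_dvd_X hkl)
  rw [isUnit_iff_constantCoeff] at hunit ⊢
  rwa [constantCoeff_algHom (le_order_substHom_X _ hs)] at hunit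

theorem isIsolatedZero_of_mem_radical {χ : Fin 3 → Series}
    (h : ∀ k, (X k : Series) ∈ (Ideal.span (Set.range χ)).radical) : IsIsolatedZero χ := by
  choose N hN using h
  refine ⟨∑ k, N k, fun k => ?_⟩
  refine Ideal.mem_of_dvd _ (pow_dvd_pow _ ?_) (hN k)
  exact (Finset.single_le_sum (f := N) (fun _ _ => Nat.zero_le _) (Finset.mem_univ k))

/-! ### Linear parts -/

theorem linearPart_apply (χ : Fin 3 → Series) (i j : Fin 3) :
    linearPart χ i j = constantCoeff (pderiv ℂ j (χ i)) := by
  rw [← coeff_zero_eq_constantCoeff_apply, coeff_pderiv]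
  simp [linearPart]

theorem linearPart_mul {χ χ' : Fin 3 → Series} {v : Series} (hχ : IsSingular χ)
    (h : ∀ i, χ' i = v * χ i) : linearPart χ' = constantCoeff v • linearPart χ := by
  ext i j
  rw [linearPart_apply, h, Matrix.smul_apply, linearPart_apply]
  simp [hχ i]

/-- If the eigenvalues are positive multiples of one number, then the cube of the trace is a positive
multiple of the determinant. This criterion is invariant under scaling. -/
theorem IsRadial.trace_pow_three {D : Set (Fin 3)} {χ : Fin 3 → Series} (h : IsRadial D χ) :
    (linearPart χ).det ≠ 0 ∧
      ∃ t : ℝ, 0 < t ∧ (linearPart χ).trace ^ 3 = t * (linearPart χ).det := by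
  obtain ⟨-, l, n, hl, hn, hc⟩ := h
  have hroots : (linearPart χ).charpoly.roots = Finset.univ.val.map fun i => l * (n i : ℂ) := by
    have hr := Polynomial.roots_multiset_prod_X_sub_C
      (Finset.univ.val.map fun i => l * (n i : ℂ))
    rw [Multiset.map_map] at hr
    rw [hc]
    exact hr
  have htr : (linearPart χ).trace = ∑ i, l * (n i : ℂ) := by
    rw [Matrix.trace_eq_sum_roots_charpoly, hroots]
    rfl
  have hdet : (linearPart χ).det = ∏ i, l * (n i : ℂ) := by
    rw [Matrix.det_eq_prod_roots_charpoly, hroots]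
    rfl
  have h0 := hn 0
  have h1 := hn 1
  have h2 := hn 2
  rw [Fin.prod_univ_three] at hdet
  rw [Fin.sum_univ_three] at htr
  refine ⟨?_, ((n 0 + n 1 + n 2) ^ 3 / (n 0 * n 1 * n 2) : ℝ), by positivity, ?_⟩
  · rw [hdet]
    have h0' : (n 0 : ℂ) ≠ 0 := Nat.cast_ne_zero.2 h0.ne'
    have h1' : (n 1 : ℂ) ≠ 0 := Nat.cast_ne_zero.2 h1.ne'
    have h2' : (n 2 : ℂ) ≠ 0 := Nat.cast_ne_zero.2 h2.ne'
    simp [hl, h0', h1', h2']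
  · have h0' : (n 0 : ℂ) ≠ 0 := Nat.cast_ne_zero.2 h0.ne'
    have h1' : (n 1 : ℂ) ≠ 0 := Nat.cast_ne_zero.2 h1.ne'
    have h2' : (n 2 : ℂ) ≠ 0 := Nat.cast_ne_zero.2 h2.ne'
    rw [htr, hdet]
    push_cast
    field_simp

/-- A sufficient condition on the linear part for being neither nilpotent nor radial. It is invariant
under scaling. -/
def IsCanonicalMatrix (M : Matrix (Fin 3) (Fin 3) ℂ) : Prop :=
  (M.trace ≠ 0 ∨ (M * M).trace ≠ 0 ∨ M.det ≠ 0) ∧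
    (M.det = 0 ∨ ∃ t : ℝ, t ≤ 0 ∧ M.trace ^ 3 = t * M.det)

theorem IsCanonicalMatrix.isCanonical {D : Set (Fin 3)} {χ χ' : Fin 3 → Series} {v : Series}
    (hM : IsCanonicalMatrix (linearPart χ)) (hv : IsUnit v) (hχ : IsSingular χ)
    (h : ∀ i, χ' i = v * χ i) (hD : IsTangent D χ') : IsCanonical D χ' := by
  have hc : constantCoeff v ≠ 0 := isUnit_iff_ne_zero.1 (isUnit_iff_constantCoeff.1 hv)
  have hlin := linearPart_mul hχ h
  obtain ⟨h1, h2⟩ := hM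
  refine ⟨⟨hD, Or.inr fun hnil => ?_⟩, fun hrad => ?_⟩
  · have htr := (Matrix.isNilpotent_trace_of_isNilpotent hnil).eq_zero
    have hsq := (Matrix.isNilpotent_trace_of_isNilpotent
      ((Commute.refl (linearPart χ')).isNilpotent_mul_right hnil)).eq_zero
    have hdet : (linearPart χ').det = 0 := by
      obtain ⟨k, hk⟩ := hnil
      have := congrArg Matrix.det hk
      rw [Matrix.det_pow, Matrix.det_zero] at this
      exact eq_zero_of_pow_eq_zero this
    rw [hlin] at htr hsq hdet
    simp only [Matrix.trace_smul, Matrix.smul_mul, Matrix.mul_smul, Matrix.det_smul,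
      smul_eq_mul, mul_eq_zero, hc, false_or, Fintype.card_fin,
      pow_eq_zero_iff, ne_eq, OfNat.ofNat_ne_zero, not_false_eq_true] at htr hsq hdet
    rcases h1 with h1 | h1 | h1 <;> contradiction
  · obtain ⟨hdet, t, ht, hrel⟩ := hrad.trace_pow_three
    rw [hlin] at hdet hrel
    simp only [Matrix.trace_smul, Matrix.det_smul, smul_eq_mul, Fintype.card_fin] at hdet hrel
    have hdet' : (linearPart χ).det ≠ 0 := right_ne_zero_of_mul hdet
    obtain ⟨s, hs, hrel'⟩ := h2.resolve_left hdet'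
    have h3 : (s : ℂ) = t := by
      apply mul_right_cancel₀ hdet
      linear_combination hrel - constantCoeff v ^ 3 * hrel'
    exact absurd (Complex.ofReal_injective h3) (by linarith)

/-! ### The saturated lift in the charts -/

section Charts

variable {A : Type*} [CommRing A]

/-- The cubic leading part of the example germ. -/
def leadingPart (v : Fin 3 → A) : Fin 3 → A :=
  ![v 1 * v 2 * (v 1 - v 2), v 0 * (v 0 ^ 2 - v 2 ^ 2), v 0 * v 2 * (v 1 - v 2)]

theorem toBaseFour_x (w : Fin 3 → A) : toBaseFour .x w = ![w 0, w 1 * w 0, w 2 * w 0] := by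
  ext i; fin_cases i <;> simp [toBaseFour, toBaseThree, toBaseTwo, toBaseOne, blowUpChart]

theorem toBaseFour_z (w : Fin 3 → A) : toBaseFour .z w = ![w 0 * w 2, w 1 * w 2, w 2] := by
  ext i; fin_cases i <;> simp [toBaseFour, toBaseThree, toBaseTwo, toBaseOne, blowUpChart]

theorem toBaseFour_yy (w : Fin 3 → A) :
    toBaseFour .yy w = ![w 0 * w 1 ^ 2, w 1, w 2 * w 1 ^ 2] := by
  ext i; fin_cases i <;> simp [toBaseFour, toBaseThree, toBaseTwo, toBaseOne, blowUpChart] <;> ring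

theorem toBaseFour_yz (w : Fin 3 → A) :
    toBaseFour .yz w = ![w 0 * w 1 * w 2 ^ 2, w 1 * w 2, w 1 * w 2 ^ 2] := by
  ext i; fin_cases i <;> simp [toBaseFour, toBaseThree, toBaseTwo, toBaseOne, blowUpChart] <;> ring

theorem toBaseFour_yxy (w : Fin 3 → A) : toBaseFour .yxy w =
    ![w 0 ^ 2 * w 1 ^ 3, w 0 * w 1 ^ 2, w 0 ^ 2 * w 1 ^ 4 * w 2] := by
  ext i; fin_cases i <;> simp [toBaseFour, toBaseThree, toBaseTwo, toBaseOne, blowUpChart] <;> ring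

theorem toBaseFour_yxxx (w : Fin 3 → A) : toBaseFour .yxxx w =
    ![w 0 ^ 4 * w 1, w 0 ^ 3 * w 1, w 0 ^ 5 * w 1 * w 2] := by
  ext i; fin_cases i <;> simp [toBaseFour, toBaseThree, toBaseTwo, toBaseOne, blowUpChart] <;> ring

theorem toBaseFour_yxxy (w : Fin 3 → A) : toBaseFour .yxxy w =
    ![w 0 ^ 3 * w 1 ^ 4, w 0 ^ 2 * w 1 ^ 3, w 0 ^ 4 * w 1 ^ 5 * w 2] := by
  ext i; fin_cases i <;> simp [toBaseFour, toBaseThree, toBaseTwo, toBaseOne, blowUpChart] <;> ring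

theorem toBaseFour_yxzz (w : Fin 3 → A) : toBaseFour .yxzz w =
    ![w 0 ^ 2 * w 1 * w 2 ^ 4, w 0 * w 1 * w 2 ^ 3, w 0 ^ 2 * w 1 * w 2 ^ 5] := by
  ext i; fin_cases i <;> simp [toBaseFour, toBaseThree, toBaseTwo, toBaseOne, blowUpChart] <;> ring

theorem toBaseFour_yxzy (w : Fin 3 → A) : toBaseFour .yxzy w =
    ![w 0 ^ 2 * w 1 ^ 4 * w 2 ^ 3, w 0 * w 1 ^ 3 * w 2 ^ 2, w 0 ^ 2 * w 1 ^ 5 * w 2 ^ 4] := by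
  ext i; fin_cases i <;> simp [toBaseFour, toBaseThree, toBaseTwo, toBaseOne, blowUpChart] <;> ring

theorem map_toBaseFour {B : Type*} [CommRing B] (φ : A →* B) (c : ChartFour) (w : Fin 3 → A)
    (i : Fin 3) : φ (toBaseFour c w i) = toBaseFour c (fun k => φ (w k)) i := by
  cases c <;> simp only [toBaseFour_x, toBaseFour_z, toBaseFour_yy, toBaseFour_yz, toBaseFour_yxy,
    toBaseFour_yxxx, toBaseFour_yxxy, toBaseFour_yxzz, toBaseFour_yxzy] <;> fin_cases i <;> simp

/-- The coordinate of `ℂ³` that generates the pullback of the maximal ideal in the chart. -/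
def mainIndex : ChartFour → Fin 3
  | .x => 0
  | .z => 2
  | _ => 1

/-- In the charts over `p₅`, the greatest common divisor of `x / y`, `z / y` and `y`, where `x, y, z`
are the coordinates of `ℂ³`; in the other charts `1`. -/
def excFactor (c : ChartFour) (w : Fin 3 → A) : A :=
  match c with
  | .x => 1
  | .z => 1
  | .yy => w 1
  | .yz => w 2
  | .yxy => w 0 * w 1
  | .yxxx => w 0
  | .yxxy => w 0 * w 1
  | .yxzz => w 0 * w 2
  | .yxzy => w 0 * w 1 * w 2

/-- The exponents of the monomial by which the lifted vector field is divided. -/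
def multiplierExp : ChartFour → Fin 3 → ℕ
  | .x => ![2, 0, 0]
  | .z => ![0, 0, 2]
  | .yy => ![0, 2, 0]
  | .yz => ![0, 2, 2]
  | .yxy => ![2, 4, 0]
  | .yxxx => ![7, 2, 0]
  | .yxxy => ![4, 7, 0]
  | .yxzz => ![2, 2, 7]
  | .yxzy => ![2, 7, 4]

/-- The monomial by which the lifted vector field is divided. -/
def multiplier (c : ChartFour) (w : Fin 3 → A) : A :=
  w 0 ^ multiplierExp c 0 * w 1 ^ multiplierExp c 1 * w 2 ^ multiplierExp c 2

/-- The saturated lift in the chart with coordinates `w` of a vector field with the cubic part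
`leadingPart`, where `t⁴ b_i` are the pullbacks of the higher order terms and `t` is the pullback
of the coordinate `mainIndex c`. In the charts over `p₅`, `a` and `s` stand for the pullbacks of the
quotients of the first and of the third coordinate of `ℂ³` by the second, and `α`, `β`, `γ` for the
logarithmic derivatives of the three coordinates divided by the multiplier. -/
def saturatedLift (c : ChartFour) (b w : Fin 3 → A) : Fin 3 → A :=
  let x := w 0
  let y := w 1
  let z := w 2
  match c with
  | .x => ![x * (y * z * (y - z) + x * b 0),
      1 - z ^ 2 - y * (y * z * (y - z)) + x * (b 1 - y * b 0),
      z * (y - z) - z * (y * z * (y - z)) + x * (b 2 - z * b 0)]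
  | .z => ![y * (y - 1) - x * (x * (y - 1)) + z * (b 0 - x * b 2),
      x * (x ^ 2 - 1) - y * (x * (y - 1)) + z * (b 1 - y * b 2),
      z * (x * (y - 1) + z * b 2)]
  | .yy => ![z * (1 - z * y) + b 0 - 2 * x * (y ^ 3 * x * (x ^ 2 - z ^ 2) + y * b 1),
      y * (y ^ 3 * x * (x ^ 2 - z ^ 2) + y * b 1),
      x * z * y * (1 - z * y) + b 2 - 2 * z * (y ^ 3 * x * (x ^ 2 - z ^ 2) + y * b 1)]
  | .yz => ![1 - z + y * b 0 - x * (x * z * (1 - z) + y * b 2),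
      y * (2 * (x * z ^ 3 * (x ^ 2 - 1) + y * z * b 1) - x * z * (1 - z) - y * b 2),
      z * (x * z * (1 - z) + y * b 2 - (x * z ^ 3 * (x ^ 2 - 1) + y * z * b 1))]
  | .yxy =>
    let a := x * y
    let s := x * y ^ 2 * z
    let β := a * (a ^ 2 - s ^ 2) + x * y ^ 2 * b 1
    ![x * (2 * y * (z * (1 - s) + b 0) - 3 * β),
      y * (2 * β - y * (z * (1 - s) + b 0)),
      z * a * (1 - s) + b 2 - 2 * z * β]
  | .yxxx =>
    let s := x ^ 2 * z
    let α := z * (1 - s) + x * y * b 0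
    let β := x ^ 2 - s ^ 2 + x ^ 2 * y * b 1
    ![x * (α - β), y * (4 * β - 3 * α), z * (1 - s) + y * b 2 + z * β - 2 * z * α]
  | .yxxy =>
    let s := x ^ 2 * y ^ 2 * z
    let α := x * z * (1 - s) + x * y * b 0
    let β := x * ((x * y) ^ 2 - s ^ 2) + x ^ 2 * y ^ 2 * b 1
    ![x * (3 * α - 4 * β), y * (3 * β - 2 * α), z * x * (1 - s) + b 2 + z * β - 2 * z * α]
  | .yxzz =>
    let s := x * z ^ 2
    let α := 1 - s + y * z * b 0
    let β := x * ((x * z) ^ 2 - s ^ 2) + x * y * z ^ 2 * b 1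
    let γ := x * (1 - s) + y * b 2
    ![x * (2 * α - γ - β), y * (2 * β + α - 2 * γ), z * (γ - α)]
  | .yxzy =>
    let s := x * y ^ 2 * z ^ 2
    let α := z * (1 - s) + y * z * b 0
    let β := x * z * ((x * y * z) ^ 2 - s ^ 2) + x * y ^ 2 * z ^ 2 * b 1
    let γ := x * z * (1 - s) + b 2
    ![x * (2 * α - γ - β), y * (2 * β - γ), z * (2 * γ - α - 2 * β)]

theorem map_saturatedLift {B : Type*} [CommRing B] (φ : A →+* B) (c : ChartFour)
    (b w : Fin 3 → A) (i : Fin 3) :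
    φ (saturatedLift c b w i) = saturatedLift c (fun k => φ (b k)) (fun k => φ (w k)) i := by
  have h2 : φ 2 = 2 := map_ofNat φ 2
  have h3 : φ 3 = 3 := map_ofNat φ 3
  have h4 : φ 4 = 4 := map_ofNat φ 4
  cases c <;> fin_cases i <;> simp [saturatedLift, h2, h3, h4]

theorem map_excFactor {B : Type*} [CommRing B] (φ : A →+* B) (c : ChartFour) (w : Fin 3 → A) :
    φ (excFactor c w) = excFactor c (fun k => φ (w k)) := by
  cases c <;> simp [excFactor]

/-- The defining property of the lift: it maps to the given vector field under the differential of
the chart map. The chart maps are monomial, so that this is a computation with exponents. -/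
theorem derivation_toBaseFour {R : Type*} [CommRing R] [Algebra R A] (D : Derivation R A A)
    (c : ChartFour) (b w : Fin 3 → A)
    (hD : ∀ k, D (w k) = multiplier c w * saturatedLift c b w k) (i : Fin 3) :
    D (toBaseFour c w i) = leadingPart (toBaseFour c w) i +
      toBaseFour c w (mainIndex c) ^ 4 * b i := by
  have h0 := hD 0
  have h1 := hD 1
  have h2 := hD 2
  cases c <;> simp [saturatedLift, multiplier, multiplierExp] at h0 h1 h2 <;>
    simp only [toBaseFour_x, toBaseFour_z, toBaseFour_yy, toBaseFour_yz, toBaseFour_yxy,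
    toBaseFour_yxxx, toBaseFour_yxxy, toBaseFour_yxzz, toBaseFour_yxzy] <;> fin_cases i <;>
    simp [leadingPart, mainIndex, Derivation.leibniz, Derivation.leibniz_pow, h0, h1, h2] <;> ring

theorem mainIndex_dvd (c : ChartFour) (w : Fin 3 → A) (i : Fin 3) :
    toBaseFour c w (mainIndex c) ∣ toBaseFour c w i := by
  cases c <;> simp only [toBaseFour_x, toBaseFour_z, toBaseFour_yy, toBaseFour_yz, toBaseFour_yxy,
    toBaseFour_yxxx, toBaseFour_yxxy, toBaseFour_yxzz, toBaseFour_yxzy, mainIndex] <;>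
    fin_cases i <;> simp
  · exact ⟨w 0 * w 1, by ring⟩
  · exact ⟨w 2 * w 1, by ring⟩
  · exact ⟨w 0 * w 2, by ring⟩
  · exact ⟨w 2, by ring⟩
  · exact ⟨w 0 * w 1, by ring⟩
  · exact ⟨w 0 * w 1 ^ 2 * w 2, by ring⟩
  · exact ⟨w 0, by ring⟩
  · exact ⟨w 0 ^ 2 * w 2, by ring⟩
  · exact ⟨w 0 * w 1, by ring⟩
  · exact ⟨w 0 ^ 2 * w 1 ^ 2 * w 2, by ring⟩
  · exact ⟨w 0 * w 2, by ring⟩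
  · exact ⟨w 0 * w 2 ^ 2, by ring⟩
  · exact ⟨w 0 * w 1 * w 2, by ring⟩
  · exact ⟨w 0 * w 1 ^ 2 * w 2 ^ 2, by ring⟩

end Charts

/-! ### The zeros of the saturated lift on the exceptional divisor -/

/-- The singular points in the chart `c`; the parameter is `r = R₀₄₀`. -/
def singularPoints (r : ℂ) : ChartFour → Set Pt
  | .x => {![0, 1, 1], ![0, -1, -1]}
  | .z => {![0, 0, 0], ![0, 1, 0], ![1, 1, 0], ![-1, 1, 0]}
  | .yy => ∅
  | .yz => {![0, 0, 1], ![1, 0, 1], ![-1, 0, 1]}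
  | .yxy => ∅
  | .yxxx => {![0, 0, 0], ![0, 0, 1 / 2], ![1, 0, 1], ![-1, 0, 1]}
  | .yxxy => ∅
  | .yxzz => {![0, 0, 0], ![0, 1 / (2 * r), 0], ![2, 0, 0], ![1, 0, 1], ![1, 0, -1]}
  | .yxzy => {![0, 0, 0], ![0, 0, 2 * r]}

section Zeros

variable {K : Type*} [CommRing K] [IsDomain K]

theorem eq_one_or_eq_neg_one_of_sq {a : K} (h : a ^ 2 - 1 = 0) : a = 1 ∨ a = -1 :=
  (mul_eq_zero.1 (by linear_combination h : (a - 1) * (a + 1) = 0)).imp sub_eq_zero.1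
    eq_neg_of_add_eq_zero_left

variable [Algebra ℂ K]

/-- Over a domain, the common zeros of the coefficients of the saturated lift on the exceptional
divisor are the points of `singularPoints`. For `K = ℂ` this determines the singular points; for
the quotients of the ring of power series by prime ideals it shows that they are isolated. -/
theorem exists_mem_singularPoints {r : ℂ} (hr : r ≠ 0) (c : ChartFour) {b w : Fin 3 → K} {g : K}
    (hb : b 2 = algebraMap ℂ K r + excFactor c w * g) (h0 : toBaseFour c w = 0)
    (h : ∀ k, saturatedLift c b w k = 0) :
    ∃ v ∈ singularPoints r c, ∀ k, w k = algebraMap ℂ K (v k) := by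
  have : CharZero K := charZero_of_injective_algebraMap (algebraMap ℂ K).injective
  have hr' : algebraMap ℂ K r ≠ 0 := by simpa using hr
  have htwo : algebraMap ℂ K 2 = 2 := map_ofNat _ 2
  have e0 := h 0
  have e1 := h 1
  have e2 := h 2
  have d := congrFun h0 (mainIndex c)
  clear h h0
  simp only [Fin.forall_fin_succ]
  cases c
  case x =>
    simp only [toBaseFour_x, mainIndex, saturatedLift, Pi.zero_apply, Matrix.cons_val_zero,
      Matrix.cons_val_one, Matrix.cons_val] at d e0 e1 e2
    simp only [d, zero_mul, add_zero] at e1 e2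
    -- the last two equations say that `[1 : y : z]` is a fixed direction of the cubic part
    have hyz : w 1 = w 2 := by
      have e3 : w 2 * ((w 1 - w 2) * (1 - w 1 * w 2)) = 0 := by linear_combination e2
      rcases mul_eq_zero.1 e3 with e4 | e4
      · rw [e4] at e1
        exact absurd e1 (by simp)
      rcases mul_eq_zero.1 e4 with e5 | e5
      · exact sub_eq_zero.1 e5
      · refine sub_eq_zero.1 (eq_zero_of_pow_eq_zero (n := 2) ?_)
        linear_combination (w 1 ^ 2 - w 1 * w 2 + 1) * e5 - e1
    rw [hyz] at e1
    rcases eq_one_or_eq_neg_one_of_sq (a := w 2) (by linear_combination -e1) with e4 | e4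
    · exact ⟨![0, 1, 1], by simp [singularPoints], by simp [d, hyz, e4]⟩
    · exact ⟨![0, -1, -1], by simp [singularPoints], by simp [d, hyz, e4]⟩
  case z =>
    simp only [toBaseFour_z, mainIndex, saturatedLift, Pi.zero_apply, Matrix.cons_val_zero,
      Matrix.cons_val_one, Matrix.cons_val] at d e0 e1 e2
    simp only [d, zero_mul, add_zero] at e0 e1
    have e3 : (w 1 - 1) * (w 1 - w 0 ^ 2) = 0 := by linear_combination e0
    have e4 : w 0 * (w 0 ^ 2 - 1) = 0 ∧ (w 1 = 1 ∨ w 1 = w 0 ^ 2) := by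
      rcases mul_eq_zero.1 e3 with e4 | e4
      · exact ⟨by linear_combination e1 + w 1 * w 0 * e4, Or.inl (sub_eq_zero.1 e4)⟩
      · refine ⟨?_, Or.inr (sub_eq_zero.1 e4)⟩
        refine eq_zero_of_pow_eq_zero (n := 2) ?_
        rw [sub_eq_zero.1 e4] at e1
        linear_combination -w 0 * e1
    obtain ⟨e4, e5⟩ := e4
    rcases mul_eq_zero.1 e4 with e6 | e6
    · rcases e5 with e5 | e5
      · exact ⟨![0, 1, 0], by simp [singularPoints], by simp [d, e5, e6]⟩
      · exact ⟨![0, 0, 0], by simp [singularPoints], by simp [d, e5, e6]⟩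
    · have e7 : w 1 = 1 := e5.elim id fun e => by linear_combination e + e6
      rcases eq_one_or_eq_neg_one_of_sq e6 with e8 | e8
      · exact ⟨![1, 1, 0], by simp [singularPoints], by simp [d, e7, e8]⟩
      · exact ⟨![-1, 1, 0], by simp [singularPoints], by simp [d, e7, e8]⟩
  case yy =>
    simp only [toBaseFour_yy, mainIndex, saturatedLift, excFactor, Pi.zero_apply,
      Matrix.cons_val_one, Matrix.cons_val] at d e2 hb
    -- on the divisor the third coefficient is the constant `r`
    exact absurd (by simpa [hb, d] using e2) hr
  case yz =>
    simp only [toBaseFour_yz, mainIndex, saturatedLift, excFactor, Pi.zero_apply,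
      Matrix.cons_val_zero, Matrix.cons_val_one, Matrix.cons_val] at d e0 e1 e2 hb
    have hy : w 1 = 0 := by
      rcases mul_eq_zero.1 d with hy | hz
      · exact hy
      · simpa [hb, hz, hr] using e1
    simp only [hy, zero_mul, add_zero] at e0 e2
    have e3 : (1 - w 2) * (1 - w 0 ^ 2 * w 2) = 0 := by linear_combination e0
    have hz : w 2 = 1 := by
      rcases mul_eq_zero.1 e3 with e4 | e4
      · exact (sub_eq_zero.1 e4).symm
      · refine (sub_eq_zero.1 (eq_zero_of_pow_eq_zero (n := 2) ?_)).symm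
        -- as `x ^ 2 * z = 1`, the factor `x ^ 3` is inverse to the factor `x * z ^ 2` of `e2`
        linear_combination w 0 ^ 3 * e2 + ((1 + w 0 ^ 2 * w 2) *
          (1 - w 2 - w 2 ^ 2 * (w 0 ^ 2 - 1)) - w 2) * e4
    have e4 : w 0 * (w 0 ^ 2 - 1) = 0 := by
      rw [hz] at e2
      linear_combination -e2
    rcases mul_eq_zero.1 e4 with e5 | e5
    · exact ⟨![0, 0, 1], by simp [singularPoints], by simp [hy, hz, e5]⟩
    rcases eq_one_or_eq_neg_one_of_sq e5 with e5 | e5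
    · exact ⟨![1, 0, 1], by simp [singularPoints], by simp [hy, hz, e5]⟩
    · exact ⟨![-1, 0, 1], by simp [singularPoints], by simp [hy, hz, e5]⟩
  case yxy =>
    simp only [toBaseFour_yxy, mainIndex, saturatedLift, excFactor, Pi.zero_apply,
      Matrix.cons_val_one, Matrix.cons_val] at d e2 hb
    -- on both components the third coefficient is the constant `r`
    rcases mul_eq_zero.1 d with hx | hy
    · exact absurd (by simpa [hb, hx] using e2) hr
    · have hy := eq_zero_of_pow_eq_zero hy
      exact absurd (by simpa [hb, hy] using e2) hr
  case yxxx =>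
    simp only [toBaseFour_yxxx, mainIndex, saturatedLift, excFactor, Pi.zero_apply,
      Matrix.cons_val_zero, Matrix.cons_val_one, Matrix.cons_val] at d e0 e1 e2 hb
    -- `q₁` and `q₂` lie on `x = 0`, the images of `p₃` and `p₄` on `y = 0`
    by_cases hx : w 0 = 0
    · have e3 : w 1 * w 2 = 0 := by simpa [hx] using e1
      have e4 : w 2 + w 1 * algebraMap ℂ K r - 2 * w 2 * w 2 = 0 := by
        simpa [hx, hb] using e2
      rcases mul_eq_zero.1 e3 with hy | hz
      · have e5 : w 2 * (1 - 2 * w 2) = 0 := by linear_combination e4 - algebraMap ℂ K r * hy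
        rcases mul_eq_zero.1 e5 with hz | hz
        · exact ⟨![0, 0, 0], by simp [singularPoints], by simp [hx, hy, hz]⟩
        · refine ⟨![0, 0, 1 / 2], by simp [singularPoints], ?_⟩
          have hz' : w 2 = algebraMap ℂ K (1 / 2) := by
            have h2 : algebraMap ℂ K (1 / 2) * 2 = 1 := by
              rw [← map_ofNat (algebraMap ℂ K) 2, ← map_mul]
              norm_num
            linear_combination -algebraMap ℂ K (1 / 2) * hz - w 2 * h2
          simpa [hx, hy] using hz'
      · have hy : w 1 = 0 := by simpa [hz, hr] using e4
        exact ⟨![0, 0, 0], by simp [singularPoints], by simp [hx, hy, hz]⟩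
    · have hy : w 1 = 0 := by simpa [hx] using d
      simp only [hy, mul_zero, zero_mul, add_zero, mul_eq_zero, hx, false_or] at e0 e2
      have e3 : w 2 * ((1 - w 0 ^ 2 * w 2) * (1 - w 2)) = 0 := by
        linear_combination e2 + w 2 * e0
      have hxz : w 0 ^ 2 - 1 = 0 ∧ w 2 = 1 := by
        rcases mul_eq_zero.1 e3 with hz | e4
        · exact absurd (by simpa [hz] using e0) hx
        rcases mul_eq_zero.1 e4 with e5 | e5
        · have e6 : w 0 ^ 2 - 1 = 0 := by
            linear_combination -e0 + (w 2 - 1 - w 0 ^ 2 * w 2) * e5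
          exact ⟨e6, by linear_combination -e5 - w 2 * e6⟩
        · have hz : w 2 = 1 := by linear_combination -e5
          refine ⟨eq_zero_of_pow_eq_zero (n := 2) ?_, hz⟩
          rw [hz] at e0
          linear_combination e0
      obtain ⟨e4, hz⟩ := hxz
      rcases eq_one_or_eq_neg_one_of_sq e4 with hx | hx
      · exact ⟨![1, 0, 1], by simp [singularPoints], by simp [hx, hy, hz]⟩
      · exact ⟨![-1, 0, 1], by simp [singularPoints], by simp [hx, hy, hz]⟩
  case yxxy =>
    simp only [toBaseFour_yxxy, mainIndex, saturatedLift, excFactor, Pi.zero_apply,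
      Matrix.cons_val_zero, Matrix.cons_val_one, Matrix.cons_val] at d e0 e2 hb
    by_cases hx : w 0 = 0
    · exact absurd (by simpa [hb, hx] using e2) hr
    · have hy : w 1 = 0 := by simpa [hx] using d
      have hz : w 2 = 0 := by simpa [hx, hy] using e0
      exact absurd (by simpa [hb, hy, hz] using e2) hr
  case yxzz =>
    simp only [toBaseFour_yxzz, mainIndex, saturatedLift, excFactor, Pi.zero_apply,
      Matrix.cons_val_zero, Matrix.cons_val_one, Matrix.cons_val] at d e0 e1 e2 hb
    -- `q₂`, `q₃`, `q₄` lie on `z = 0`, there are no further zeros on `x = 0`, and the images of `p₃`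
    -- and `p₄` lie on `y = 0`
    by_cases hz : w 2 = 0
    · by_cases hx : w 0 = 0
      · have e3 : w 1 * (1 - 2 * (w 1 * algebraMap ℂ K r)) = 0 := by simpa [hx, hz, hb] using e1
        rcases mul_eq_zero.1 e3 with hy | hy
        · exact ⟨![0, 0, 0], by simp [singularPoints], by simp [hx, hy, hz]⟩
        · refine ⟨![0, 1 / (2 * r), 0], by simp [singularPoints], ?_⟩
          have hy' : w 1 = algebraMap ℂ K (1 / (2 * r)) := by
            have h2 : algebraMap ℂ K (1 / (2 * r)) * (2 * algebraMap ℂ K r) = 1 := by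
              rw [← map_ofNat (algebraMap ℂ K) 2, ← map_mul, ← map_mul,
                one_div_mul_cancel (mul_ne_zero two_ne_zero hr), map_one]
            linear_combination -algebraMap ℂ K (1 / (2 * r)) * hy - w 1 * h2
          simpa [hx, hz] using hy'
      · have e3 : 2 - (w 0 + w 1 * b 2) = 0 := by simpa [hx, hz] using e0
        have e4 : w 1 * (1 - 2 * (w 0 + w 1 * b 2)) = 0 := by simpa [hz] using e1
        have hy : w 1 = 0 := by
          have e5 : w 1 * 3 = 0 := by linear_combination 2 * w 1 * e3 - e4
          simpa using e5
        have hx' : w 0 = 2 := by linear_combination -e3 - b 2 * hy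
        exact ⟨![2, 0, 0], by simp [singularPoints], by simp [hx', hy, hz, htwo]⟩
    · by_cases hx : w 0 = 0
      · have e3 : w 1 * algebraMap ℂ K r - (1 + w 1 * w 2 * b 0) = 0 := by
          simpa [hx, hz, hb] using e2
        have e4 : w 1 * (1 + w 1 * w 2 * b 0 - 2 * (w 1 * algebraMap ℂ K r)) = 0 := by
          simpa [hx, hb] using e1
        have hy : w 1 = 0 := by
          have e5 : w 1 * (w 1 * algebraMap ℂ K r) = 0 := by linear_combination -e4 - w 1 * e3
          simpa [hr] using e5
        exact absurd e3 (by simp [hy])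
      · have hy : w 1 = 0 := by simpa [hx, hz] using d
        simp only [hy, mul_zero, zero_mul, add_zero, mul_eq_zero, hx, hz, false_or] at e0 e2
        have e3 : (1 - w 0 * w 2 ^ 2) * (w 0 - 1) = 0 := by linear_combination e2
        have hxz : w 0 = 1 ∧ w 2 ^ 2 - 1 = 0 := by
          rcases mul_eq_zero.1 e3 with e4 | e4
          · have e5 : w 0 * (w 0 - 1) = 0 := by
              linear_combination (2 - w 0 - w 0 * (1 + w 0 * w 2 ^ 2) + w 0 ^ 2) * e4 - e0
            have hx' : w 0 = 1 := by simpa [hx, sub_eq_zero] using e5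
            exact ⟨hx', by rw [hx'] at e4; linear_combination -e4⟩
          · have hx' : w 0 = 1 := by linear_combination e4
            refine ⟨hx', eq_zero_of_pow_eq_zero (n := 2) ?_⟩
            rw [hx'] at e0
            linear_combination e0
        obtain ⟨hx', e4⟩ := hxz
        rcases eq_one_or_eq_neg_one_of_sq e4 with hz' | hz'
        · exact ⟨![1, 0, 1], by simp [singularPoints], by simp [hx', hy, hz']⟩
        · exact ⟨![1, 0, -1], by simp [singularPoints], by simp [hx', hy, hz']⟩
  case yxzy =>
    simp only [toBaseFour_yxzy, mainIndex, saturatedLift, excFactor, Pi.zero_apply,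
      Matrix.cons_val_zero, Matrix.cons_val_one, Matrix.cons_val] at d e0 e1 e2 hb
    by_cases hz : w 2 = 0
    · have hx : w 0 = 0 := by simpa [hz, hb, hr] using e0
      have hy : w 1 = 0 := by simpa [hz, hb, hr] using e1
      exact ⟨![0, 0, 0], by simp [singularPoints], by simp [hx, hy, hz]⟩
    · have hy : w 1 = 0 := by
        by_contra hy
        have hx : w 0 = 0 := by simpa [hy, hz] using d
        exact hr (by simpa [hx, hy, hb] using e1)
      have e3 : 2 * (w 0 * w 2 + algebraMap ℂ K r) - w 2 = 0 := by simpa [hy, hz, hb] using e2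
      have hx : w 0 = 0 := by
        by_contra hx
        have e4 : 2 * w 2 - (w 0 * w 2 + algebraMap ℂ K r) = 0 := by simpa [hx, hy, hb] using e0
        have e5 : w 2 * 3 = 0 := by linear_combination 2 * e4 + e3
        exact hz (by simpa using e5)
      have hz' : w 2 = 2 * algebraMap ℂ K r := by linear_combination -e3 + 2 * w 2 * hx
      exact ⟨![0, 0, 2 * r], by simp [singularPoints], by simp [hx, hy, hz', htwo]⟩

end Zeros

/-! ### The singular points in the charts -/

set_option maxHeartbeats 2000000 in
/-- The linear parts at the singular points. At `p₁`, `p₂`, `p₃`, `p₄`, `q₁` the determinant is zero, at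
`q₄`, `q₅` the trace, and at `q₂`, `q₃` the ratio of the cube of the trace to the determinant is
negative. -/
theorem isCanonicalMatrix_linearPart {r : ℂ} (hr : r ≠ 0) (c : ChartFour) {v : Pt}
    (hv : v ∈ singularPoints r c) {b : Fin 3 → Series} {g : Series}
    (hb : b 2 = C r + excFactor c (fun k => C (v k) + X k) * g) :
    IsCanonicalMatrix (linearPart (saturatedLift c b fun k => C (v k) + X k)) := by
  have hX : ∀ i j : Fin 3, pderiv ℂ i (X j : Series) = if i = j then 1 else 0 := fun i j => by
    rw [pderiv_X, Pi.single_apply]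
    simp [eq_comm]
  have h2 : ∀ i, pderiv ℂ i (2 : Series) = 0 := fun i => (pderiv ℂ i).map_natCast 2
  have h3 : ∀ i, pderiv ℂ i (3 : Series) = 0 := fun i => (pderiv ℂ i).map_natCast 3
  have h4 : ∀ i, pderiv ℂ i (4 : Series) = 0 := fun i => (pderiv ℂ i).map_natCast 4
  have c2 : constantCoeff (2 : Series) = 2 := map_ofNat constantCoeff 2
  have c3 : constantCoeff (3 : Series) = 3 := map_ofNat constantCoeff 3
  have c4 : constantCoeff (4 : Series) = 4 := map_ofNat constantCoeff 4
  have hr' : r⁻¹ * 2⁻¹ * r = 2⁻¹ := by field_simp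
  cases c <;> simp only [singularPoints, Set.mem_insert_iff, Set.mem_singleton_iff,
    Set.mem_empty_iff_false] at hv
  case' x => rcases hv with rfl | rfl
  case' z => rcases hv with rfl | rfl | rfl | rfl
  case' yz => rcases hv with rfl | rfl | rfl
  case' yxxx => rcases hv with rfl | rfl | rfl | rfl
  case' yxzz => rcases hv with rfl | rfl | rfl | rfl | rfl
  case' yxzy => rcases hv with rfl | rfl
  all_goals
    simp only [IsCanonicalMatrix, Matrix.trace_fin_three, Matrix.det_fin_three, Matrix.mul_apply,
      Fin.sum_univ_three, linearPart_apply, saturatedLift, hb, excFactor, Matrix.cons_val_zero,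
      Matrix.cons_val_one, Matrix.cons_val, map_add, map_sub, Derivation.leibniz,
      Derivation.leibniz_pow, hX, pderiv_C, smul_eq_mul, map_mul, constantCoeff_X,
      constantCoeff_C, h2, h3, h4, c2, c3, c4]
    simp [c2, c3, hr, hr']
  all_goals norm_num
  · exact ⟨0, le_rfl, by push_cast; ring⟩
  · have h : 2 * (2 * r) - r ≠ 0 := by
      rw [show 2 * (2 * r) - r = 3 * r by ring]
      exact mul_ne_zero three_ne_zero hr
    exact ⟨Or.inr (Or.inr h), Or.inr ⟨0, le_rfl, by push_cast; ring⟩⟩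
  · exact ⟨-4, by norm_num, by norm_num⟩
  · exact ⟨0, le_rfl, by push_cast; field_simp; norm_num⟩
  · exact ⟨-32 / 3, by norm_num, by norm_num⟩
  · exact ⟨-32 / 3, by norm_num, by norm_num⟩

theorem isSingular_saturatedLift {r : ℂ} (hr : r ≠ 0) (c : ChartFour) {v : Pt}
    (hv : v ∈ singularPoints r c) {b : Fin 3 → Series} {g : Series}
    (hb : b 2 = C r + excFactor c (fun k => C (v k) + X k) * g) :
    IsSingular (saturatedLift c b fun k => C (v k) + X k) := by
  intro i
  rw [map_saturatedLift]
  have hb' : constantCoeff (b 2) = r + excFactor c v * constantCoeff g := by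
    rw [hb, map_add, map_mul, constantCoeff_C, map_excFactor]
    simp
  simp only [map_add, constantCoeff_C, constantCoeff_X, add_zero]
  cases c <;> simp only [singularPoints, Set.mem_insert_iff, Set.mem_singleton_iff,
    Set.mem_empty_iff_false] at hv
  case' x => rcases hv with rfl | rfl
  case' z => rcases hv with rfl | rfl | rfl | rfl
  case' yz => rcases hv with rfl | rfl | rfl
  case' yxxx => rcases hv with rfl | rfl | rfl | rfl
  case' yxzz => rcases hv with rfl | rfl | rfl | rfl | rfl
  case' yxzy => rcases hv with rfl | rfl
  all_goals fin_cases i <;> simp [saturatedLift, hb', excFactor]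
  refine Or.inr ?_
  field_simp
  norm_num

theorem toBaseFour_eq_zero_of_mem_singularPoints {r : ℂ} (c : ChartFour) {v : Pt}
    (hv : v ∈ singularPoints r c) : toBaseFour c v = 0 := by
  cases c <;> simp only [singularPoints, Set.mem_insert_iff, Set.mem_singleton_iff,
    Set.mem_empty_iff_false] at hv
  case' x => rcases hv with rfl | rfl
  case' z => rcases hv with rfl | rfl | rfl | rfl
  case' yz => rcases hv with rfl | rfl | rfl
  case' yxxx => rcases hv with rfl | rfl | rfl | rfl
  case' yxzz => rcases hv with rfl | rfl | rfl | rfl | rfl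
  case' yxzy => rcases hv with rfl | rfl
  all_goals
    ext i
    fin_cases i <;> simp [toBaseFour_x, toBaseFour_z, toBaseFour_yz, toBaseFour_yxxx,
      toBaseFour_yxzz, toBaseFour_yxzy]

theorem isTangent_saturatedLift (c : ChartFour) (b : Fin 3 → Series) (v : Pt) :
    IsTangent (excComponents c v) (saturatedLift c b fun k => C (v k) + X k) := by
  rintro i ⟨hi, hw⟩
  -- `π₀` vanishes on an exceptional plane `w_i = 0`, in particular at its point with `w_k = 1` for
  -- all `k ≠ i`
  have h := congrFun (hw (fun k => if k = i then 0 else 1) (by simp)) (mainIndex c)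
  have key : ∀ a : Series, (X i : Series) ∣ (C (v i) + X i) * a := fun a => by
    rw [hi, map_zero, zero_add]
    exact dvd_mul_right _ _
  cases c <;> fin_cases i <;> simp [mainIndex, toBaseFour_x, toBaseFour_z, toBaseFour_yy,
    toBaseFour_yz, toBaseFour_yxy, toBaseFour_yxxx, toBaseFour_yxxy, toBaseFour_yxzz,
    toBaseFour_yxzy] at h <;> exact key _

/-! ### Coordinate changes between the charts -/

theorem analyticAt_coord (i : Fin 3) (u : Pt) : AnalyticAt ℂ (fun w : Pt => w i) u :=
  (ContinuousLinearMap.proj (R := ℂ) (φ := fun _ : Fin 3 => ℂ) i).analyticAt u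

theorem analyticAt_vec {f g h : Pt → ℂ} {u : Pt} (hf : AnalyticAt ℂ f u) (hg : AnalyticAt ℂ g u)
    (hh : AnalyticAt ℂ h u) : AnalyticAt ℂ (fun w => ![f w, g w, h w]) u :=
  analyticAt_pi_iff.2 fun i => by fin_cases i <;> assumption

theorem eventually_coord_ne {i : Fin 3} {u : Pt} (h : u i ≠ 0) : ∀ᶠ w : Pt in 𝓝 u, w i ≠ 0 :=
  (continuous_apply i).continuousAt.eventually_ne h

theorem mk_z_eq_mk_x (a : Pt) (h0 : a 0 ≠ 0) :
    XFour.mk .z a = XFour.mk .x ![a 0 * a 2, a 1 / a 0, 1 / a 0] := by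
  set b : Pt := ![a 0 * a 2, a 1 / a 0, 1 / a 0] with hb
  have k2 : b 2 ≠ 0 := by simp [hb, h0]
  refine Quotient.sound ⟨fun w => ![w 0 * w 2, w 1 / w 0, 1 / w 0], fun w => ![1 / w 2, w 1 / w 2, w 0 * w 2],
    analyticAt_vec ((analyticAt_coord 0 _).mul (analyticAt_coord 2 _)) ((analyticAt_coord 1 _).div (analyticAt_coord 0 _) h0) (analyticAt_const.div (analyticAt_coord 0 _) h0), rfl, ?_,
    analyticAt_vec (analyticAt_const.div (analyticAt_coord 2 _) k2) ((analyticAt_coord 1 _).div (analyticAt_coord 2 _) k2) ((analyticAt_coord 0 _).mul (analyticAt_coord 2 _)), ?_, ?_⟩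
  · filter_upwards [eventually_coord_ne h0] with w w0
    simp only [toBaseFour_z, toBaseFour_x]
    ext i
    fin_cases i <;> simp <;> field_simp
  · ext i
    fin_cases i <;> simp [hb] <;> field_simp
  · filter_upwards [eventually_coord_ne (u := b) k2] with w w2
    simp only [toBaseFour_z, toBaseFour_x]
    ext i
    fin_cases i <;> simp <;> field_simp

theorem mk_z_eq_mk_yz (a : Pt) (h1 : a 1 ≠ 0) :
    XFour.mk .z a = XFour.mk .yz ![a 0, a 1 ^ 2 * a 2, 1 / a 1] := by
  set b : Pt := ![a 0, a 1 ^ 2 * a 2, 1 / a 1] with hb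
  have k2 : b 2 ≠ 0 := by simp [hb, h1]
  refine Quotient.sound ⟨fun w => ![w 0, w 1 ^ 2 * w 2, 1 / w 1], fun w => ![w 0, 1 / w 2, w 1 * w 2 ^ 2],
    analyticAt_vec (analyticAt_coord 0 _) (((analyticAt_coord 1 _).pow 2).mul (analyticAt_coord 2 _)) (analyticAt_const.div (analyticAt_coord 1 _) h1), rfl, ?_,
    analyticAt_vec (analyticAt_coord 0 _) (analyticAt_const.div (analyticAt_coord 2 _) k2) ((analyticAt_coord 1 _).mul ((analyticAt_coord 2 _).pow 2)), ?_, ?_⟩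
  · filter_upwards [eventually_coord_ne h1] with w w1
    simp only [toBaseFour_z, toBaseFour_yz]
    ext i
    fin_cases i <;> simp <;> field_simp
  · ext i
    fin_cases i <;> simp [hb] <;> field_simp
  · filter_upwards [eventually_coord_ne (u := b) k2] with w w2
    simp only [toBaseFour_z, toBaseFour_yz]
    ext i
    fin_cases i <;> simp <;> field_simp

theorem mk_z_eq_mk_yxxx (a : Pt) (h0 : a 0 ≠ 0) (h1 : a 1 ≠ 0) :
    XFour.mk .z a = XFour.mk .yxxx ![a 0 / a 1, a 1 ^ 4 * a 2 / a 0 ^ 3, a 1 / a 0 ^ 2] := by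
  set b : Pt := ![a 0 / a 1, a 1 ^ 4 * a 2 / a 0 ^ 3, a 1 / a 0 ^ 2] with hb
  have k0 : b 0 ≠ 0 := by simp [hb, h0, h1]
  have k2 : b 2 ≠ 0 := by simp [hb, h0, h1]
  refine Quotient.sound ⟨fun w => ![w 0 / w 1, w 1 ^ 4 * w 2 / w 0 ^ 3, w 1 / w 0 ^ 2], fun w => ![1 / (w 0 * w 2), 1 / (w 0 ^ 2 * w 2), w 0 ^ 5 * w 1 * w 2],
    analyticAt_vec ((analyticAt_coord 0 _).div (analyticAt_coord 1 _) h1) ((((analyticAt_coord 1 _).pow 4).mul (analyticAt_coord 2 _)).div ((analyticAt_coord 0 _).pow 3) (pow_ne_zero _ h0)) ((analyticAt_coord 1 _).div ((analyticAt_coord 0 _).pow 2) (pow_ne_zero _ h0)), rfl, ?_,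
    analyticAt_vec (analyticAt_const.div ((analyticAt_coord 0 _).mul (analyticAt_coord 2 _)) (mul_ne_zero k0 k2)) (analyticAt_const.div (((analyticAt_coord 0 _).pow 2).mul (analyticAt_coord 2 _)) (mul_ne_zero (pow_ne_zero _ k0) k2)) ((((analyticAt_coord 0 _).pow 5).mul (analyticAt_coord 1 _)).mul (analyticAt_coord 2 _)), ?_, ?_⟩
  · filter_upwards [eventually_coord_ne h0, eventually_coord_ne h1] with w w0 w1
    simp only [toBaseFour_z, toBaseFour_yxxx]
    ext i
    fin_cases i <;> simp <;> field_simp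
  · ext i
    fin_cases i <;> simp [hb] <;> field_simp
  · filter_upwards [eventually_coord_ne (u := b) k0, eventually_coord_ne (u := b) k2] with w w0 w2
    simp only [toBaseFour_z, toBaseFour_yxxx]
    ext i
    fin_cases i <;> simp <;> field_simp

theorem mk_z_eq_mk_yxzz (a : Pt) (h0 : a 0 ≠ 0) (h1 : a 1 ≠ 0) :
    XFour.mk .z a = XFour.mk .yxzz ![a 0 ^ 2 / a 1, a 0 * a 1 ^ 2 * a 2, 1 / a 0] := by
  set b : Pt := ![a 0 ^ 2 / a 1, a 0 * a 1 ^ 2 * a 2, 1 / a 0] with hb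
  have k0 : b 0 ≠ 0 := by simp [hb, h0, h1]
  have k2 : b 2 ≠ 0 := by simp [hb, h0]
  refine Quotient.sound ⟨fun w => ![w 0 ^ 2 / w 1, w 0 * w 1 ^ 2 * w 2, 1 / w 0], fun w => ![1 / w 2, 1 / (w 0 * w 2 ^ 2), w 0 ^ 2 * w 1 * w 2 ^ 5],
    analyticAt_vec (((analyticAt_coord 0 _).pow 2).div (analyticAt_coord 1 _) h1) (((analyticAt_coord 0 _).mul ((analyticAt_coord 1 _).pow 2)).mul (analyticAt_coord 2 _)) (analyticAt_const.div (analyticAt_coord 0 _) h0), rfl, ?_,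
    analyticAt_vec (analyticAt_const.div (analyticAt_coord 2 _) k2) (analyticAt_const.div ((analyticAt_coord 0 _).mul ((analyticAt_coord 2 _).pow 2)) (mul_ne_zero k0 (pow_ne_zero _ k2))) ((((analyticAt_coord 0 _).pow 2).mul (analyticAt_coord 1 _)).mul ((analyticAt_coord 2 _).pow 5)), ?_, ?_⟩
  · filter_upwards [eventually_coord_ne h0, eventually_coord_ne h1] with w w0 w1
    simp only [toBaseFour_z, toBaseFour_yxzz]
    ext i
    fin_cases i <;> simp <;> field_simp
  · ext i
    fin_cases i <;> simp [hb] <;> field_simp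
  · filter_upwards [eventually_coord_ne (u := b) k0, eventually_coord_ne (u := b) k2] with w w0 w2
    simp only [toBaseFour_z, toBaseFour_yxzz]
    ext i
    fin_cases i <;> simp <;> field_simp

theorem mk_yxxx_eq_mk_yxzz (a : Pt) (h2 : a 2 ≠ 0) :
    XFour.mk .yxxx a = XFour.mk .yxzz ![1 / a 2, a 1 / a 2 ^ 2, a 0 * a 2] := by
  set b : Pt := ![1 / a 2, a 1 / a 2 ^ 2, a 0 * a 2] with hb
  have k0 : b 0 ≠ 0 := by simp [hb, h2]
  refine Quotient.sound ⟨fun w => ![1 / w 2, w 1 / w 2 ^ 2, w 0 * w 2], fun w => ![w 0 * w 2, w 1 / w 0 ^ 2, 1 / w 0],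
    analyticAt_vec (analyticAt_const.div (analyticAt_coord 2 _) h2) ((analyticAt_coord 1 _).div ((analyticAt_coord 2 _).pow 2) (pow_ne_zero _ h2)) ((analyticAt_coord 0 _).mul (analyticAt_coord 2 _)), rfl, ?_,
    analyticAt_vec ((analyticAt_coord 0 _).mul (analyticAt_coord 2 _)) ((analyticAt_coord 1 _).div ((analyticAt_coord 0 _).pow 2) (pow_ne_zero _ k0)) (analyticAt_const.div (analyticAt_coord 0 _) k0), ?_, ?_⟩
  · filter_upwards [eventually_coord_ne h2] with w w2
    simp only [toBaseFour_yxxx, toBaseFour_yxzz]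
    ext i
    fin_cases i <;> simp <;> field_simp
  · ext i
    fin_cases i <;> simp [hb] <;> field_simp
  · filter_upwards [eventually_coord_ne (u := b) k0] with w w0
    simp only [toBaseFour_yxxx, toBaseFour_yxzz]
    ext i
    fin_cases i <;> simp <;> field_simp

theorem mk_yxzz_eq_mk_yxzy (a : Pt) (h1 : a 1 ≠ 0) :
    XFour.mk .yxzz a = XFour.mk .yxzy ![a 0, a 1 * a 2, 1 / a 1] := by
  set b : Pt := ![a 0, a 1 * a 2, 1 / a 1] with hb
  have k2 : b 2 ≠ 0 := by simp [hb, h1]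
  refine Quotient.sound ⟨fun w => ![w 0, w 1 * w 2, 1 / w 1], fun w => ![w 0, 1 / w 2, w 1 * w 2],
    analyticAt_vec (analyticAt_coord 0 _) ((analyticAt_coord 1 _).mul (analyticAt_coord 2 _)) (analyticAt_const.div (analyticAt_coord 1 _) h1), rfl, ?_,
    analyticAt_vec (analyticAt_coord 0 _) (analyticAt_const.div (analyticAt_coord 2 _) k2) ((analyticAt_coord 1 _).mul (analyticAt_coord 2 _)), ?_, ?_⟩
  · filter_upwards [eventually_coord_ne h1] with w w1
    simp only [toBaseFour_yxzz, toBaseFour_yxzy]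
    ext i
    fin_cases i <;> simp <;> field_simp
  · ext i
    fin_cases i <;> simp [hb] <;> field_simp
  · filter_upwards [eventually_coord_ne (u := b) k2] with w w2
    simp only [toBaseFour_yxzz, toBaseFour_yxzy]
    ext i
    fin_cases i <;> simp <;> field_simp

theorem vec_congr {a b c a' b' c' : ℂ} (ha : a = a') (hb : b = b') (hc : c = c') :
    ![a, b, c] = ![a', b', c'] := by rw [ha, hb, hc]

/-- The points of `singularPoints` in the various charts represent the nine points. -/
theorem mk_mem_of_mem_singularPoints {r : ℂ} (hr : r ≠ 0) (c : ChartFour) {v : Pt}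
    (hv : v ∈ singularPoints r c) :
    XFour.mk c v ∈ ({p₁, p₂, p₃, p₄, q₁, q₂, q₃, q₄ r, q₅} : Set XFour) := by
  have x₃ : XFour.mk .x ![0, 1, 1] = p₃ := by
    rw [p₃, mk_z_eq_mk_x _ (by simp)]
    exact congrArg _ (vec_congr (by simp) (by simp) (by simp))
  have x₄ : XFour.mk .x ![0, -1, -1] = p₄ := by
    rw [p₄, mk_z_eq_mk_x _ (by simp)]
    exact congrArg _ (vec_congr (by simp) (by norm_num) (by norm_num))
  have yz₂ : XFour.mk .yz ![0, 0, 1] = p₂ := by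
    rw [p₂, mk_z_eq_mk_yz _ (by simp)]
    exact congrArg _ (vec_congr (by simp) (by simp) (by simp))
  have yz₃ : XFour.mk .yz ![1, 0, 1] = p₃ := by
    rw [p₃, mk_z_eq_mk_yz _ (by simp)]
    exact congrArg _ (vec_congr (by simp) (by simp) (by simp))
  have yz₄ : XFour.mk .yz ![-1, 0, 1] = p₄ := by
    rw [p₄, mk_z_eq_mk_yz _ (by simp)]
    exact congrArg _ (vec_congr (by simp) (by simp) (by simp))
  have yxxx₃ : XFour.mk .yxxx ![1, 0, 1] = p₃ := by
    rw [p₃, mk_z_eq_mk_yxxx _ (by simp) (by simp)]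
    exact congrArg _ (vec_congr (by simp) (by simp) (by simp))
  have yxxx₄ : XFour.mk .yxxx ![-1, 0, 1] = p₄ := by
    rw [p₄, mk_z_eq_mk_yxxx _ (by simp) (by simp)]
    exact congrArg _ (vec_congr (by simp) (by simp) (by simp))
  have yxzz₃ : XFour.mk .yxzz ![1, 0, 1] = p₃ := by
    rw [p₃, mk_z_eq_mk_yxzz _ (by simp) (by simp)]
    exact congrArg _ (vec_congr (by simp) (by simp) (by simp))
  have yxzz₄ : XFour.mk .yxzz ![1, 0, -1] = p₄ := by
    rw [p₄, mk_z_eq_mk_yxzz _ (by simp) (by simp)]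
    exact congrArg _ (vec_congr (by simp) (by simp) (by norm_num))
  have yxzz₂ : XFour.mk .yxzz ![2, 0, 0] = q₂ := by
    rw [q₂, mk_yxxx_eq_mk_yxzz _ (by simp)]
    exact congrArg _ (vec_congr (by simp) (by simp) (by simp))
  have yxzy₄ : XFour.mk .yxzy ![0, 0, 2 * r] = q₄ r := by
    rw [q₄, mk_yxzz_eq_mk_yxzy _ (by simp [hr])]
    exact congrArg _ (vec_congr (by simp) (by simp) (by simp))
  cases c <;> simp only [singularPoints, Set.mem_insert_iff, Set.mem_singleton_iff,
    Set.mem_empty_iff_false] at hv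
  case' x => rcases hv with rfl | rfl
  case' z => rcases hv with rfl | rfl | rfl | rfl
  case' yz => rcases hv with rfl | rfl | rfl
  case' yxxx => rcases hv with rfl | rfl | rfl | rfl
  case' yxzz => rcases hv with rfl | rfl | rfl | rfl | rfl
  case' yxzy => rcases hv with rfl | rfl
  all_goals
    try simp only [x₃, x₄, yz₂, yz₃, yz₄, yxxx₃, yxxx₄, yxzz₃, yxzz₄, yxzz₂, yxzy₄]
    simp [p₁, p₂, p₃, p₄, q₁, q₂, q₃, q₄, q₅]

/-- Each of the nine points is represented by a point of `singularPoints`. -/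
theorem exists_mem_singularPoints_of_mem {r : ℂ} {p : XFour}
    (hp : p ∈ ({p₁, p₂, p₃, p₄, q₁, q₂, q₃, q₄ r, q₅} : Set XFour)) :
    ∃ c, ∃ v ∈ singularPoints r c, XFour.mk c v = p := by
  simp only [Set.mem_insert_iff, Set.mem_singleton_iff] at hp
  rcases hp with rfl | rfl | rfl | rfl | rfl | rfl | rfl | rfl | rfl
  · exact ⟨.z, ![0, 0, 0], by simp [singularPoints], rfl⟩
  · exact ⟨.z, ![0, 1, 0], by simp [singularPoints], rfl⟩
  · exact ⟨.z, ![1, 1, 0], by simp [singularPoints], rfl⟩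
  · exact ⟨.z, ![-1, 1, 0], by simp [singularPoints], rfl⟩
  · exact ⟨.yxxx, ![0, 0, 0], by simp [singularPoints], rfl⟩
  · exact ⟨.yxxx, ![0, 0, 1 / 2], by simp [singularPoints], rfl⟩
  · exact ⟨.yxzz, ![0, 0, 0], by simp [singularPoints], rfl⟩
  · exact ⟨.yxzz, ![0, 1 / (2 * r), 0], by simp [singularPoints], rfl⟩
  · exact ⟨.yxzy, ![0, 0, 0], by simp [singularPoints], rfl⟩

/-! ### Lifting the example germ -/

theorem leadingPart_X_order (i : Fin 3) :
    3 ≤ (leadingPart (X : Fin 3 → Series) i).order := by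
  have hX : ∀ i, 1 ≤ (X i : Series).order := fun i => by
    rw [one_le_order_iff_constCoeff_eq_zero]
    exact constantCoeff_X i
  have h3 : (3 : ℕ∞) = 1 + 1 + 1 := by norm_num
  have hsub : ∀ i j, 1 ≤ (X i - X j : Series).order := fun i j => le_order_sub (hX i) (hX j)
  fin_cases i <;> simp only [leadingPart, h3]
  · exact le_order_mul_of_le (le_order_mul_of_le (hX 1) (hX 2)) (hsub 1 2)
  · rw [add_assoc]
    refine le_order_mul_of_le (hX 0) (le_order_sub ?_ ?_) <;> rw [pow_two] <;>
      exact le_order_mul_of_le (hX _) (hX _)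
  · exact le_order_mul_of_le (le_order_mul_of_le (hX 0) (hX 2)) (hsub 1 2)

/-- The infinitesimal generator of the example germ has the same terms of degree `3` and `4` as
`f - id`. -/
theorem exists_generator_exampleGerm {P Q R : Series} (hP : 4 ≤ P.order) (hQ : 4 ≤ Q.order)
    (hR : 4 ≤ R.order) :
    ∃ χ H : Fin 3 → Series, IsInfinitesimalGenerator χ (exampleGerm P Q R) ∧
      (∀ i, χ i = leadingPart X i + H i) ∧ (∀ i, 4 ≤ (H i).order) ∧
      coeff (Finsupp.single 1 4) (H 2) = coeff (Finsupp.single 1 4) R := by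
  have hf : ∀ i, exampleGerm P Q R i - X i = leadingPart X i + ![P, Q, R] i := by
    intro i
    fin_cases i <;> simp [exampleGerm, leadingPart] <;> ring
  have hPQR : ∀ i, 4 ≤ ((![P, Q, R] : Fin 3 → Series) i).order := by
    intro i
    fin_cases i <;> assumption
  have hord : ∀ i, 3 ≤ (exampleGerm P Q R i - X i).order := fun i => by
    rw [hf]
    exact le_order_add (leadingPart_X_order i) (le_trans (by norm_num) (hPQR i))
  obtain ⟨χ, hχ⟩ := exists_isInfinitesimalGenerator fun i => le_trans (by norm_num) (hord i)
  have hχ' := isInfinitesimalGenerator_iff.1 hχ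
  have hχ3 : ∀ i, 3 ≤ (χ i).order := fun i => by
    have h1 := le_order_flow_sub_linear (a := 1) le_rfl (by exact_mod_cast hχ'.1) i
    rw [← hχ'.2] at h1
    have h2 := le_order_sub (hord i) (le_trans (by norm_num) h1)
    rwa [sub_sub_cancel] at h2
  have h5 : ∀ i, 5 ≤ (exampleGerm P Q R i - X i - χ i).order := fun i => by
    have h1 := le_order_flow_sub_linear (a := 2) (by norm_num) (by exact_mod_cast hχ3) i
    rw [← hχ'.2] at h1
    exact_mod_cast h1
  have hH : ∀ i, χ i - leadingPart X i =
      (![P, Q, R] : Fin 3 → Series) i - (exampleGerm P Q R i - X i - χ i) := fun i => by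
    rw [hf]
    ring
  refine ⟨χ, fun i => χ i - leadingPart X i, hχ, fun i => by ring, fun i => ?_, ?_⟩
  · beta_reduce
    rw [hH]
    exact le_order_sub (hPQR i) (le_trans (by norm_num) (h5 i))
  · beta_reduce
    rw [hH, map_sub, (natCast_le_order_iff (N := 5)).1 (h5 2) _ (by simp), sub_zero]
    rfl

/-- The coordinates of the chart, expanded at the point `u`. -/
noncomputable def centred (u : Pt) : Fin 3 → Series := fun k => C (u k) + X k

theorem constantCoeff_centred (u : Pt) (k : Fin 3) : constantCoeff (centred u k) = u k := by
  simp [centred]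

theorem constantCoeff_toBaseFour_centred {c : ChartFour} {u : Pt} (hu : toBaseFour c u = 0)
    (i : Fin 3) : constantCoeff (toBaseFour c (centred u) i) = 0 := by
  have h := map_toBaseFour (constantCoeff (σ := Fin 3) (R := ℂ) : Series →* ℂ) c (centred u) i
  simp only [MonoidHom.coe_coe, constantCoeff_centred] at h
  rw [h, hu, Pi.zero_apply]

theorem centred_ne_zero (u : Pt) (k : Fin 3) : centred u k ≠ 0 := by
  intro h
  have := congrArg (coeff (Finsupp.single k 1)) h
  simp [centred, coeff_C] at this

theorem isUnit_or_prime_centred (u : Pt) (k : Fin 3) :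
    IsUnit (centred u k) ∨ Prime (centred u k) := by
  by_cases h : u k = 0
  · right
    rw [centred, h, map_zero, zero_add]
    exact prime_X k
  · left
    rw [isUnit_iff_constantCoeff, constantCoeff_centred]
    exact isUnit_iff_ne_zero.2 h

theorem multiplier_ne_zero {A : Type*} [CommRing A] [IsDomain A] (c : ChartFour) {w : Fin 3 → A}
    (h : ∀ k, w k ≠ 0) : multiplier c w ≠ 0 :=
  mul_ne_zero (mul_ne_zero (pow_ne_zero _ (h 0)) (pow_ne_zero _ (h 1))) (pow_ne_zero _ (h 2))

/-- Through every point of the exceptional divisor passes one of its components, and the multiplier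
vanishes on it to order at least two. -/
theorem exists_component {c : ChartFour} {u : Pt} (hu : toBaseFour c u = 0) :
    ∃ k, u k = 0 ∧ 2 ≤ multiplierExp c k ∧
      ∀ (A : Type) [CommRing A] (w : Fin 3 → A), w k = 0 → toBaseFour c w = 0 := by
  have h := congrFun hu (mainIndex c)
  have h1 : u 0 = 0 ∧ 2 ≤ multiplierExp c 0 ∧ (c = .x ∨ c = .yxy ∨ c = .yxxx ∨ c = .yxxy ∨
      c = .yxzz ∨ c = .yxzy) ∨ u 1 = 0 ∧ 2 ≤ multiplierExp c 1 ∧ c ≠ .x ∧ c ≠ .z ∨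
      u 2 = 0 ∧ 2 ≤ multiplierExp c 2 ∧ (c = .z ∨ c = .yz ∨ c = .yxzz ∨ c = .yxzy) := by
    cases c <;> simp [mainIndex, toBaseFour_x, toBaseFour_z, toBaseFour_yy, toBaseFour_yz,
      toBaseFour_yxy, toBaseFour_yxxx, toBaseFour_yxxy, toBaseFour_yxzz, toBaseFour_yxzy] at h <;>
      simp [multiplierExp] <;> tauto
  rcases h1 with ⟨h, h2, h3⟩ | ⟨h, h2, h3⟩ | ⟨h, h2, h3⟩
  · refine ⟨0, h, h2, fun A _ w hw => ?_⟩
    rcases h3 with rfl | rfl | rfl | rfl | rfl | rfl <;> ext i <;> fin_cases i <;>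
      simp [toBaseFour_x, toBaseFour_yxy, toBaseFour_yxxx, toBaseFour_yxxy, toBaseFour_yxzz,
        toBaseFour_yxzy, hw]
  · refine ⟨1, h, h2, fun A _ w hw => ?_⟩
    cases c <;> simp at h3 <;> ext i <;> fin_cases i <;>
      simp [toBaseFour_yy, toBaseFour_yz, toBaseFour_yxy, toBaseFour_yxxx, toBaseFour_yxxy,
        toBaseFour_yxzz, toBaseFour_yxzy, hw]
  · refine ⟨2, h, h2, fun A _ w hw => ?_⟩
    rcases h3 with rfl | rfl | rfl | rfl <;> ext i <;> fin_cases i <;>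
      simp [toBaseFour_z, toBaseFour_yz, toBaseFour_yxzz, toBaseFour_yxzy, hw]

theorem le_order_multiplier {c : ChartFour} {u : Pt} (hu : toBaseFour c u = 0) :
    2 ≤ (multiplier c (centred u)).order := by
  obtain ⟨k, hk, hk2, -⟩ := exists_component hu
  have h1 : 1 ≤ (centred u k).order := by
    rw [one_le_order_iff_constCoeff_eq_zero, constantCoeff_centred, hk]
  have h2 : centred u k ^ 2 ∣ multiplier c (centred u) := by
    refine (pow_dvd_pow _ hk2).trans ?_
    rw [multiplier]
    fin_cases k
    · exact (dvd_mul_right _ _).mul_right _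
    · exact (dvd_mul_left _ _).mul_right _
    · exact dvd_mul_left _ _
  obtain ⟨a, ha⟩ := h2
  rw [ha, pow_two]
  have := le_order_mul_of_le (le_order_mul_of_le h1 h1) (zero_le (a := a.order))
  rwa [add_zero, one_add_one_eq_two] at this

/-- The strict transforms of the higher order terms. Over `p₅`, the third one is determined modulo
`excFactor` by the coefficient of `y⁴`; in the two other charts `excFactor` is `1`, and the second
condition is void. -/
theorem exists_strictTransform {c : ChartFour} {u : Pt} {H : Fin 3 → Series}
    (hH : ∀ i, 4 ≤ (H i).order) (σ : Series →ₐ[ℂ] Series)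
    (hσ : ∀ i, σ (X i) = toBaseFour c (centred u) i) :
    ∃ (b : Fin 3 → Series) (g : Series),
      (∀ i, σ (H i) = toBaseFour c (centred u) (mainIndex c) ^ 4 * b i) ∧
      b 2 = C (coeff (Finsupp.single 1 4) (H 2)) + excFactor c (centred u) * g := by
  have hd : ∀ i, σ (X (mainIndex c)) ∣ σ (X i) := fun i => by
    rw [hσ, hσ]
    exact mainIndex_dvd c _ i
  choose b hb using fun i => exists_algHom_eq_pow_mul σ (mainIndex c) hd 4 (H i) (hH i)
  simp only [hσ] at hb
  by_cases hc : excFactor c (centred u) = 1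
  · exact ⟨b, b 2 - C (coeff (Finsupp.single 1 4) (H 2)), hb, by rw [hc]; ring⟩
  have key : mainIndex c = 1 ∧ excFactor c (centred u) ∣ σ (X 1) ∧
      ∀ i, i ≠ 1 → ∃ t, σ (X i) = σ (X 1) * (excFactor c (centred u) * t) := by
    simp only [hσ]
    generalize centred u = w at hc ⊢
    refine ⟨?_, ?_, fun i hi => ?_⟩
    · cases c <;> first | rfl | exact absurd rfl hc
    · cases c
      case x => exact absurd rfl hc
      case z => exact absurd rfl hc
      case yy => exact ⟨1, by simp [excFactor, toBaseFour_yy]⟩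
      case yz => exact ⟨w 1, by simp [excFactor, toBaseFour_yz]; ring⟩
      case yxy => exact ⟨w 1, by simp [excFactor, toBaseFour_yxy]; ring⟩
      case yxxx => exact ⟨w 0 ^ 2 * w 1, by simp [excFactor, toBaseFour_yxxx]; ring⟩
      case yxxy => exact ⟨w 0 * w 1 ^ 2, by simp [excFactor, toBaseFour_yxxy]; ring⟩
      case yxzz => exact ⟨w 1 * w 2 ^ 2, by simp [excFactor, toBaseFour_yxzz]; ring⟩
      case yxzy => exact ⟨w 1 ^ 2 * w 2, by simp [excFactor, toBaseFour_yxzy]; ring⟩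
    · have hi' : i = 0 ∨ i = 2 := by
        revert hi
        clear * -
        revert i
        decide
      cases c
      case x => exact absurd rfl hc
      case z => exact absurd rfl hc
      case yy =>
        rcases hi' with rfl | rfl
        · exact ⟨w 0, by simp [excFactor, toBaseFour_yy]; ring⟩
        · exact ⟨w 2, by simp [excFactor, toBaseFour_yy]; ring⟩
      case yz =>
        rcases hi' with rfl | rfl
        · exact ⟨w 0, by simp [excFactor, toBaseFour_yz]; ring⟩
        · exact ⟨1, by simp [excFactor, toBaseFour_yz]; ring⟩
      case yxy =>
        rcases hi' with rfl | rfl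
        · exact ⟨1, by simp [excFactor, toBaseFour_yxy]; ring⟩
        · exact ⟨w 1 * w 2, by simp [excFactor, toBaseFour_yxy]; ring⟩
      case yxxx =>
        rcases hi' with rfl | rfl
        · exact ⟨1, by simp [excFactor, toBaseFour_yxxx]; ring⟩
        · exact ⟨w 0 * w 2, by simp [excFactor, toBaseFour_yxxx]; ring⟩
      case yxxy =>
        rcases hi' with rfl | rfl
        · exact ⟨1, by simp [excFactor, toBaseFour_yxxy]; ring⟩
        · exact ⟨w 0 * w 1 * w 2, by simp [excFactor, toBaseFour_yxxy]; ring⟩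
      case yxzz =>
        rcases hi' with rfl | rfl
        · exact ⟨1, by simp [excFactor, toBaseFour_yxzz]; ring⟩
        · exact ⟨w 2, by simp [excFactor, toBaseFour_yxzz]; ring⟩
      case yxzy =>
        rcases hi' with rfl | rfl
        · exact ⟨1, by simp [excFactor, toBaseFour_yxzy]; ring⟩
        · exact ⟨w 1 * w 2, by simp [excFactor, toBaseFour_yxzy]; ring⟩
  obtain ⟨hm, he, ht⟩ := key
  obtain ⟨g, hg⟩ := exists_algHom_eq_pow_mul_coeff_add σ _ he ht 4 (H 2) (hH 2)
  refine ⟨fun i => if i = 2 then C (coeff (Finsupp.single 1 4) (H 2)) +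
    excFactor c (centred u) * g else b i, g, fun i => ?_, by simp⟩
  by_cases hi : i = 2
  · subst hi
    simp only [if_true]
    rw [hg, hσ, hm]
  · simp only [if_neg hi]
    exact hb i

theorem blowUpChart_ne_zero {A : Type*} [CommRing A] [IsDomain A] (S : Finset (Fin 3)) (j : Fin 3)
    {w : Fin 3 → A} (h : ∀ k, w k ≠ 0) (k : Fin 3) : blowUpChart S j w k ≠ 0 := by
  rw [blowUpChart]
  split_ifs
  · exact mul_ne_zero (h k) (h j)
  · exact h k

theorem blowUpChart_injective {A : Type*} [CommRing A] [IsDomain A] {S : Finset (Fin 3)}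
    {j : Fin 3} {w w' : Fin 3 → A} (h : ∀ k, w k ≠ 0)
    (heq : blowUpChart S j w = blowUpChart S j w') : w = w' := by
  have hj : w j = w' j := by simpa [blowUpChart] using congrFun heq j
  ext k
  have hk := congrFun heq k
  simp only [blowUpChart] at hk
  split_ifs at hk
  · rw [← hj] at hk
    exact mul_right_cancel₀ (h j) hk
  · exact hk

/-- The chart maps are injective outside the coordinate planes, also on triples of power series.
Hence lifts are unique. -/
theorem toBaseFour_injective {A : Type*} [CommRing A] [IsDomain A] {c : ChartFour}
    {w w' : Fin 3 → A} (h : ∀ k, w k ≠ 0) (heq : toBaseFour c w = toBaseFour c w') : w = w' := by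
  have h1 := fun S j => blowUpChart_ne_zero S j h
  have h2 := fun S j S' j' => blowUpChart_ne_zero S j (h1 S' j')
  have h3 := fun S j S' j' S'' j'' => blowUpChart_ne_zero S j (h2 S' j' S'' j'')
  cases c
  case x => exact blowUpChart_injective h heq
  case z => exact blowUpChart_injective h heq
  case yy => exact blowUpChart_injective h (blowUpChart_injective (h1 _ _) heq)
  case yz => exact blowUpChart_injective h (blowUpChart_injective (h1 _ _) heq)
  case yxy => exact blowUpChart_injective h (blowUpChart_injective (h1 _ _)
    (blowUpChart_injective (h2 _ _ _ _) heq))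
  all_goals exact blowUpChart_injective h (blowUpChart_injective (h1 _ _)
    (blowUpChart_injective (h2 _ _ _ _) (blowUpChart_injective (h3 _ _ _ _ _ _) heq)))

/-! ### The saturated generator of the lift -/

/-- The flow as a multiplicative map. -/
noncomputable def flowHom {χ : Fin 3 → Series} (hχ : ∀ i, 2 ≤ (χ i).order) : Series →* Series where
  toFun := flow χ
  map_one' := by
    have h0 : flow χ 0 = 0 := by
      ext m
      simp [flow, coeff_formalSum, flowTerm,
        Function.iterate_fixed (f := applyField χ) (x := 0) (by simp [applyField])]
    have h1 := flow_C_add χ 1 0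
    simpa [h0] using h1
  map_mul' := flow_mul hχ

theorem constantCoeff_flow_X (χ : Fin 3 → Series) (k : Fin 3) :
    constantCoeff (flow χ (X k)) = 0 := by
  rw [← coeff_zero_eq_constantCoeff_apply, flow, coeff_formalSum]
  simp [flowTerm]

theorem C_add_flow_X_ne_zero {χ : Fin 3 → Series} (hχ : ∀ i, 2 ≤ (χ i).order) (a : ℂ) (k : Fin 3) :
    C a + flow χ (X k) ≠ 0 := by
  intro h
  have h1 := congrArg (coeff (Finsupp.single k 1)) h
  have h2 : coeff (Finsupp.single k 1) (χ k) = 0 :=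
    (natCast_le_order_iff (N := 2)).1 (by exact_mod_cast hχ k) _ (by simp)
  simp [flow, coeff_formalSum, Finset.sum_range_succ, flowTerm, applyField_X, h2, coeff_C] at h1

instance isDomain_series : IsDomain Series := NoZeroDivisors.to_isDomain _

/-- At a prime ideal of the ring of power series at the point `u`, the saturated lift vanishes
together with the equations of the exceptional divisor only if `u` is one of the listed singular
points and the prime ideal is maximal. -/
theorem mem_singularPoints_and_X_mem {r : ℂ} (hr : r ≠ 0) {c : ChartFour} {u : Pt}
    {b : Fin 3 → Series} {g : Series} (hb : b 2 = C r + excFactor c (centred u) * g)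
    (p : Ideal Series) [p.IsPrime] (h0 : ∀ i, toBaseFour c (centred u) i ∈ p)
    (h : ∀ k, saturatedLift c b (centred u) k ∈ p) :
    u ∈ singularPoints r c ∧ ∀ k, (X k : Series) ∈ p := by
  have hC : ∀ a : ℂ, Ideal.Quotient.mk p (C a) = algebraMap ℂ (Series ⧸ p) a := fun _ => rfl
  have h0' : toBaseFour c (fun k => Ideal.Quotient.mk p (centred u k)) = 0 := by
    funext i
    have h1 := map_toBaseFour (Ideal.Quotient.mk p : Series →* Series ⧸ p) c (centred u) i
    simp only [MonoidHom.coe_coe] at h1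
    rw [← h1]
    exact Ideal.Quotient.eq_zero_iff_mem.2 (h0 i)
  obtain ⟨v, hv, hw⟩ := exists_mem_singularPoints (K := Series ⧸ p) hr c
    (b := fun k => Ideal.Quotient.mk p (b k)) (g := Ideal.Quotient.mk p g)
    (by rw [hb, map_add, map_mul, map_excFactor, hC]) h0' fun k => by
      rw [← map_saturatedLift]
      exact Ideal.Quotient.eq_zero_iff_mem.2 (h k)
  have hmem : ∀ k, C (u k - v k) + X k ∈ p := fun k => by
    have h1 := hw k
    rw [← hC, Ideal.Quotient.eq] at h1
    convert h1 using 1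
    rw [centred, map_sub]
    ring
  have huv : ∀ k, u k = v k := fun k => by
    by_contra hne
    refine Ideal.IsPrime.ne_top ‹_› (Ideal.eq_top_of_isUnit_mem _ (hmem k) ?_)
    rw [isUnit_iff_constantCoeff]
    simpa [sub_eq_zero] using hne
  refine ⟨funext huv ▸ hv, fun k => ?_⟩
  have h1 := hmem k
  rwa [huv k, sub_self, map_zero, zero_add] at h1

/-- The common zeros of the coefficients are isolated on a component of the exceptional divisor. -/
theorem isPrimitiveField_saturatedLift {r : ℂ} (hr : r ≠ 0) {c : ChartFour} {u : Pt}
    (hu : toBaseFour c u = 0) {b : Fin 3 → Series} {g : Series}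
    (hb : b 2 = C r + excFactor c (centred u) * g) :
    IsPrimitiveField (saturatedLift c b (centred u)) := by
  obtain ⟨i, hi, -, hcomp⟩ := exists_component hu
  refine isPrimitiveField_of_mem_radical i fun k => ?_
  rw [Ideal.radical_eq_sInf, Ideal.mem_sInf]
  rintro p ⟨hle, hp⟩
  have hXi : (X i : Series) ∈ p :=
    hle (Ideal.mem_sup_right (Ideal.mem_span_singleton_self _))
  refine (mem_singularPoints_and_X_mem hr hb p (fun j => ?_) fun j =>
    hle (Ideal.mem_sup_left (Ideal.subset_span ⟨j, rfl⟩))).2 k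
  have h1 := map_toBaseFour (Ideal.Quotient.mk p : Series →* Series ⧸ p) c (centred u) j
  simp only [MonoidHom.coe_coe] at h1
  rw [hcomp _ fun k => Ideal.Quotient.mk p (centred u k)] at h1
  · exact Ideal.Quotient.eq_zero_iff_mem.1 h1
  · refine Ideal.Quotient.eq_zero_iff_mem.2 ?_
    rwa [centred, hi, map_zero, zero_add]

/-- At every point of the exceptional divisor, the explicit field `saturatedLift`, for suitable `b`,
is a saturated generator of the lift, and it is the only one up to units. If the origin is an
isolated fixed point, its coefficients define an isolated zero whenever it is singular. -/
theorem exists_saturatedLift {P Q R : Series} (hP : 4 ≤ P.order) (hQ : 4 ≤ Q.order)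
    (hR : 4 ≤ R.order) (hr : coeff (Finsupp.single 1 4) R ≠ 0) {c : ChartFour} {u : Pt}
    (hu : toBaseFour c u = 0) :
    ∃ (b : Fin 3 → Series) (g : Series),
      b 2 = C (coeff (Finsupp.single 1 4) R) + excFactor c (centred u) * g ∧
      IsSaturatedGenerator (exampleGerm P Q R) c u (saturatedLift c b (centred u)) ∧
      (∀ χ, IsSaturatedGenerator (exampleGerm P Q R) c u χ →
        ∃ v, IsUnit v ∧ ∀ i, χ i = v * saturatedLift c b (centred u) i) ∧
      (IsIsolatedZero (fun i => exampleGerm P Q R i - X i) → ∀ p : Ideal Series, p.IsPrime →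
        (∀ i, saturatedLift c b (centred u) i ∈ p) → ∀ k, (X k : Series) ∈ p) := by
  obtain ⟨χ, H, hχ, hχH, hH, hHR⟩ := exists_generator_exampleGerm hP hQ hR
  have hχ' := isInfinitesimalGenerator_iff.1 hχ
  have hs := constantCoeff_toBaseFour_centred hu
  set s := toBaseFour c (centred u) with hs_def
  set σ := substHom s hs with hσ_def
  have hσX : ∀ i, σ (X i) = s i := substHom_X s hs
  have hσ1 : ∀ i, 1 ≤ (σ (X i)).order := le_order_substHom_X s hs
  obtain ⟨b, g, hb, hbg⟩ := exists_strictTransform hH σ hσX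
  rw [hHR] at hbg
  set ξ : Fin 3 → Series := fun k => multiplier c (centred u) * saturatedLift c b (centred u) k
    with hξ_def
  have hξ2 : ∀ i, 2 ≤ (ξ i).order := fun i => by
    have := le_order_mul_of_le (le_order_multiplier hu)
      (zero_le (a := (saturatedLift c b (centred u) i).order))
    rwa [add_zero] at this
  -- `ξ` is the lift of `χ`
  have hξχ : ∀ i, applyField ξ (σ (X i)) = σ (χ i) := fun i => by
    have hD : ∀ k, fieldDerivation ξ (centred u k) =
        multiplier c (centred u) * saturatedLift c b (centred u) k := fun k => by
      have hC : fieldDerivation ξ (C (u k)) = 0 := (fieldDerivation ξ).map_algebraMap (u k)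
      rw [centred, map_add, hC, zero_add, fieldDerivation_apply, applyField_X]
    have hl : σ (leadingPart X i) = leadingPart s i := by
      fin_cases i <;> simp [leadingPart, hσX]
    rw [hσX, ← fieldDerivation_apply, derivation_toBaseFour _ c b _ hD, hχH, map_add, hl, hb]
  have hflow : ∀ φ, flow ξ (σ φ) = σ (flow χ φ) :=
    flow_map σ.toLinearMap (le_order_algHom hσ1) hχ'.1 (applyField_algHom hσ1 hξχ)
  have hlift : IsLift (exampleGerm P Q R) c u fun k => flow ξ (X k) := by
    refine ⟨constantCoeff_flow_X ξ, funext fun i => ?_⟩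
    have h1 := map_toBaseFour (flowHom hξ2) c (centred u) i
    have h2 : ∀ φ, flowHom hξ2 φ = flow ξ φ := fun _ => rfl
    simp only [h2, centred, flow_C_add] at h1
    rw [← h1, hχ'.2 i]
    exact (congrArg (flow ξ) (hσX i)).symm.trans ((hflow _).trans (substHom_apply s hs _))
  have hgen : IsInfinitesimalGenerator ξ fun k => flow ξ (X k) :=
    isInfinitesimalGenerator_iff.2 ⟨hξ2, fun _ => rfl⟩
  have hprim := isPrimitiveField_saturatedLift hr hu hbg
  refine ⟨b, g, hbg, ⟨_, ξ, hlift, hgen,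
    ⟨_, multiplier_ne_zero c (centred_ne_zero u), fun _ => rfl⟩, hprim⟩, ?_, ?_⟩
  · rintro χ₁ ⟨g₁, ξ₁, hlift₁, hgen₁, ⟨h, -, hh⟩, hprim₁⟩
    have hg : (fun k => flow ξ (X k)) = g₁ := by
      have h1 := toBaseFour_injective (fun k => C_add_flow_X_ne_zero hξ2 (u k) k)
        (hlift.2.trans hlift₁.2.symm)
      exact funext fun k => add_left_cancel (congrFun h1 k)
    obtain rfl : ξ = ξ₁ := hgen.unique (hg ▸ hgen₁)
    exact exists_unit_mul_eq hprim hprim₁ (isUnit_or_prime_centred u) (multiplierExp c) hh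
  · rintro ⟨N, hN⟩ p hp hmem
    refine (mem_singularPoints_and_X_mem hr hbg p (fun i => ?_) hmem).2
    have hle : Ideal.span (Set.range fun i => exampleGerm P Q R i - X i) ≤
        p.comap σ.toRingHom := by
      refine Ideal.span_le.2 ?_
      rintro _ ⟨j, rfl⟩
      have h1 := flow_X_sub_X_mem_span hχ'.1 j
      rw [← hχ'.2] at h1
      refine (Ideal.span_le.2 ?_ : Ideal.span (Set.range χ) ≤ p.comap σ.toRingHom) h1
      rintro _ ⟨k, rfl⟩
      change σ (χ k) ∈ p
      rw [← hξχ]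
      exact Ideal.sum_mem _ fun l _ => Ideal.mul_mem_right _ _ (Ideal.mul_mem_left _ _ (hmem l))
    have h1 : σ (X i ^ N) ∈ p := hle (hN i)
    rw [map_pow, hσX] at h1
    exact hp.mem_of_pow_mem N h1

theorem isSingular_iff_of_unit_mul {χ χ' : Fin 3 → Series} {v : Series} (hv : IsUnit v)
    (h : ∀ i, χ' i = v * χ i) : IsSingular χ' ↔ IsSingular χ := by
  have hc : constantCoeff v ≠ 0 := isUnit_iff_ne_zero.1 (isUnit_iff_constantCoeff.1 hv)
  refine forall_congr' fun i => ?_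
  rw [h, map_mul, mul_eq_zero, or_iff_right hc]

theorem isSingular_saturatedLift_iff {r : ℂ} (hr : r ≠ 0) {c : ChartFour} {u : Pt}
    (hu : toBaseFour c u = 0) {b : Fin 3 → Series} {g : Series}
    (hb : b 2 = C r + excFactor c (centred u) * g) :
    IsSingular (saturatedLift c b (centred u)) ↔ u ∈ singularPoints r c := by
  refine ⟨fun h => ?_, fun h => isSingular_saturatedLift hr c h hb⟩
  have hp : (RingHom.ker (constantCoeff : Series →+* ℂ)).IsPrime := RingHom.ker_isPrime _
  exact (mem_singularPoints_and_X_mem hr hb (RingHom.ker (constantCoeff : Series →+* ℂ))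
    (constantCoeff_toBaseFour_centred hu) h).1

end BlowUpResolution

theorem proposition2 (P Q R : MvPowerSeries (Fin 3) ℂ)
    (hPc : IsConvergent P) (hQc : IsConvergent Q) (hRc : IsConvergent R)
    (hP : 4 ≤ P.order) (hQ : 4 ≤ Q.order) (hR : 4 ≤ R.order)
    (hR040 : MvPowerSeries.coeff (Finsupp.single 1 4) R ≠ 0) :
    -- the saturated generator of the lift is defined at every point of the exceptional divisor
    (∀ (c : ChartFour) (u : Pt), toBaseFour c u = 0 →
      ∃ χ, IsSaturatedGenerator (exampleGerm P Q R) c u χ) ∧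
    -- its singular points
    {p : XFour | p.proj = 0 ∧ IsSingularPoint (exampleGerm P Q R) p} =
      {p₁, p₂, p₃, p₄, q₁, q₂, q₃, q₄ (MvPowerSeries.coeff (Finsupp.single 1 4) R), q₅} ∧
    -- they are canonical, and isolated even in `X₄` when the origin is an isolated fixed point
    (∀ (c : ChartFour) (u : Pt) (χ : Fin 3 → MvPowerSeries (Fin 3) ℂ), toBaseFour c u = 0 →
      IsSaturatedGenerator (exampleGerm P Q R) c u χ → IsSingular χ →
        IsCanonical (excComponents c u) χ ∧
        (IsIsolatedZero (fun i => exampleGerm P Q R i - MvPowerSeries.X i) →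
          IsIsolatedZero χ)) := by
  refine ⟨fun c u hu => ?_, Set.ext fun p => ⟨?_, fun hp => ?_⟩, fun c u χ hu hχ hsing => ?_⟩
  · obtain ⟨b, g, -, hgen, -⟩ := exists_saturatedLift hP hQ hR hR040 hu
    exact ⟨_, hgen⟩
  · rintro ⟨hp, c, u, χ, rfl, hχ, hsing⟩
    have hu : toBaseFour c u = 0 := hp
    obtain ⟨b, g, hb, -, huniq, -⟩ := exists_saturatedLift hP hQ hR hR040 hu
    obtain ⟨v, hv, hχv⟩ := huniq χ hχ
    exact mk_mem_of_mem_singularPoints hR040 c ((isSingular_saturatedLift_iff hR040 hu hb).1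
      ((isSingular_iff_of_unit_mul hv hχv).1 hsing))
  · obtain ⟨c, u, hmem, rfl⟩ := exists_mem_singularPoints_of_mem hp
    have hu := toBaseFour_eq_zero_of_mem_singularPoints c hmem
    obtain ⟨b, g, hb, hgen, -, -⟩ := exists_saturatedLift hP hQ hR hR040 hu
    exact ⟨hu, c, u, _, rfl, hgen, (isSingular_saturatedLift_iff hR040 hu hb).2 hmem⟩
  · obtain ⟨b, g, hb, -, huniq, hiso⟩ := exists_saturatedLift hP hQ hR hR040 hu
    obtain ⟨v, hv, hχv⟩ := huniq χ hχ
    have hsing' := (isSingular_iff_of_unit_mul hv hχv).1 hsing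
    have hmem := (isSingular_saturatedLift_iff hR040 hu hb).1 hsing'
    refine ⟨(isCanonicalMatrix_linearPart hR040 c hmem hb).isCanonical hv hsing' hχv
      fun i hi => ?_, fun h => isIsolatedZero_of_mem_radical fun k => ?_⟩
    · rw [hχv]
      exact (isTangent_saturatedLift c b u i hi).mul_left v
    · rw [Ideal.radical_eq_sInf, Ideal.mem_sInf]
      rintro p ⟨hle, hp⟩
      refine hiso h p hp (fun i => ?_) k
      have h1 : χ i ∈ p := hle (Ideal.subset_span ⟨i, rfl⟩)
      rw [hχv] at h1
      exact (hp.mem_or_mem h1).resolve_left fun hvp =>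
        hp.ne_top (Ideal.eq_top_of_isUnit_mem _ hvp hv)
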